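/- Let $m\ge 1$ and let $\mathbb{CH}^m$ be complex hyperbolic space of complex dimension $m$ with the metric of constant holomorphic sectional curvature $-4$, that is, the open unit ball of $\mathbb{C}^m$ with the Riemannian metric $g_z(v,w)=\operatorname{Re}\left(\frac{\langle v,w\rangle}{1-|z|^2}+\frac{\langle v,z\rangle\langle z,w\rangle}{(1-|z|^2)^2}\right)$. Fix a point $x_0\in\mathbb{CH}^m$ and let $\rho(x)=\operatorname{dist}_{\mathbb{CH}^m}(x,x_0)$ be the Riemannian distance to $x_0$. Then, for every smooth function $\phi:\mathbb{CH}^m\to\mathbb{R}$ with compact support, $$\int_{\mathbb{CH}^m}\left(m^2+\frac{1}{4\rho^2}+\frac{(m-1)^2}{\sinh^2\rho}-\frac{1}{\sinh^2(2\rho)}\right)\phi^2\;\le\;\int_{\mathbb{CH}^m}|\nabla\phi|^2,$$ where both integrals are taken with respect to the Riemannian measure, both integrands are integrable, and $|\nabla\phi|$ is the Riemannian norm of the gradient. Moreover, at every point $x\neq x_0$, $$\frac{1}{4\rho^2}+\frac{(m-1)^2}{\sinh^2\rho}-\frac{1}{\sinh^2(2\rho)}>0.$$ -/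

import Mathlib

open MeasureTheory Manifold
open scoped ContDiff

noncomputable section

/-- The Hermitian space `ℂ^m`, with the real inner product `Re ⟨v, w⟩` (a type synonym, so that its
real structure is the restriction of scalars of its complex one). -/
def Cn (m : ℕ) : Type := EuclideanSpace ℂ (Fin m)

namespace Cn

variable {m : ℕ}

instance : NormedAddCommGroup (Cn m) :=
  inferInstanceAs (NormedAddCommGroup (EuclideanSpace ℂ (Fin m)))

instance : InnerProductSpace ℂ (Cn m) :=
  inferInstanceAs (InnerProductSpace ℂ (EuclideanSpace ℂ (Fin m)))

instance : InnerProductSpace ℝ (Cn m) := InnerProductSpace.complexToReal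

instance : FiniteDimensional ℂ (Cn m) :=
  inferInstanceAs (FiniteDimensional ℂ (EuclideanSpace ℂ (Fin m)))

instance : FiniteDimensional ℝ (Cn m) := FiniteDimensional.complexToReal (Cn m)

instance : MeasurableSpace (Cn m) := borel (Cn m)

instance : BorelSpace (Cn m) := ⟨rfl⟩

/-- The standard real frame `e_k, i e_k` of `ℂ^m`. -/
def frame (p : Fin m × Fin 2) : Cn m :=
  (EuclideanSpace.single p.1 (![1, Complex.I] p.2) : EuclideanSpace ℂ (Fin m))

end Cn

/-- Complex hyperbolic space of complex dimension `m`: the open unit ball of `ℂ^m`. It is equipped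
below with the metric of constant holomorphic sectional curvature `-4`. -/
def CH (m : ℕ) : Type := Metric.ball (0 : Cn m) 1

namespace CH

variable {m : ℕ}

/-- The inclusion of the ball in `ℂ^m`. -/
def val (z : CH m) : Cn m := Subtype.val z

instance : TopologicalSpace (CH m) :=
  inferInstanceAs (TopologicalSpace (Metric.ball (0 : Cn m) 1))

instance : MeasurableSpace (CH m) :=
  inferInstanceAs (MeasurableSpace (Metric.ball (0 : Cn m) 1))

instance : BorelSpace (CH m) :=
  inferInstanceAs (BorelSpace (Metric.ball (0 : Cn m) 1))

instance : Nonempty (CH m) := ⟨⟨0, by simp⟩⟩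

theorem isOpenEmbedding_val : Topology.IsOpenEmbedding (val : CH m → Cn m) :=
  Metric.isOpen_ball.isOpenEmbedding_subtypeVal

theorem norm_val_lt_one (z : CH m) : ‖z.val‖ < 1 := mem_ball_zero_iff.1 z.2

/-- The smooth structure is the one for which the inclusion in `ℂ^m` is a global chart. -/
instance : ChartedSpace (Cn m) (CH m) :=
  isOpenEmbedding_val.singletonChartedSpace

instance : IsManifold 𝓘(ℝ, Cn m) ω (CH m) :=
  isOpenEmbedding_val.isManifold_singleton

/-- The real inner product of `ℂ^m`, as a real bilinear form. -/
def euclid (m : ℕ) : Cn m →L[ℝ] Cn m →L[ℝ] ℝ := innerSL ℝ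

/-- The Bergman metric at a point `z` of the ball, normalized to have holomorphic sectional curvature
`-4`, as a real bilinear form on `ℂ^m`. -/
def metricAt (z : Cn m) :
    Cn m →L[ℝ] Cn m →L[ℝ] ℝ :=
  (1 - ‖z‖ ^ 2)⁻¹ • euclid m + ((1 - ‖z‖ ^ 2)⁻¹ ^ 2) •
    ((euclid m z).smulRight (euclid m z) +
      (euclid m (Complex.I • z)).smulRight (euclid m (Complex.I • z)))

theorem euclid_apply (v w : Cn m) : euclid m v w = (inner ℂ v w).re := by
  rfl

/-- `g_z(v, w) = Re (⟨v, w⟩ / (1 - |z|²) + ⟨v, z⟩ ⟨z, w⟩ / (1 - |z|²)²)`. -/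
theorem metricAt_apply (z v w : Cn m) :
    metricAt z v w = (inner ℂ v w).re / (1 - ‖z‖ ^ 2) +
      (inner ℂ v z * inner ℂ z w).re / (1 - ‖z‖ ^ 2) ^ 2 := by
  have h : inner ℂ v z = (starRingEnd ℂ) (inner ℂ z v) :=
    (inner_conj_symm v z).symm
  simp only [metricAt, add_apply, smul_apply,
    ContinuousLinearMap.smulRight_apply, euclid_apply, smul_eq_mul, inner_smul_left, h, Complex.mul_re,
    Complex.conj_re, Complex.conj_im, Complex.conj_I, Complex.neg_re, Complex.neg_im, Complex.I_re,
    Complex.I_im]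
  field_simp
  ring

theorem metricAt_symm (z v w : Cn m) : metricAt z v w = metricAt z w v := by
  simp only [metricAt, add_apply, smul_apply, ContinuousLinearMap.smulRight_apply, smul_eq_mul]
  rw [show euclid m v w = euclid m w v from real_inner_comm w v]
  ring

theorem metricAt_self (z : CH m) (v : Cn m) :
    ‖v‖ ^ 2 ≤ metricAt z.val v v := by
  have h1 := norm_val_lt_one z
  have h2 : 0 < 1 - ‖z.val‖ ^ 2 := by nlinarith [norm_nonneg z.val]
  have h3 : 1 ≤ (1 - ‖z.val‖ ^ 2)⁻¹ := one_le_inv_iff₀.2 ⟨h2, by nlinarith [norm_nonneg z.val]⟩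
  have h4 : euclid m v v = ‖v‖ ^ 2 := by
    rw [euclid, innerSL_apply_apply, real_inner_self_eq_norm_sq]
  simp only [metricAt, add_apply, smul_apply,
    ContinuousLinearMap.smulRight_apply, smul_eq_mul, h4]
  have h5 : 0 ≤ ((1 - ‖z.val‖ ^ 2)⁻¹ ^ 2) * (euclid m z.val v * euclid m z.val v +
      euclid m (Complex.I • z.val) v * euclid m (Complex.I • z.val) v) :=
    mul_nonneg (sq_nonneg _) (add_nonneg (mul_self_nonneg _) (mul_self_nonneg _))
  nlinarith [sq_nonneg ‖v‖]

theorem contDiffOn_metricAt : ContDiffOn ℝ ω (metricAt (m := m)) (Metric.ball 0 1) := by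
  have h0 : ∀ z ∈ Metric.ball (0 : Cn m) 1, 1 - ‖z‖ ^ 2 ≠ 0 := by
    intro z hz
    have := mem_ball_zero_iff.1 hz
    nlinarith [norm_nonneg z]
  have h1 : ContDiffOn ℝ ω (fun z : Cn m => (1 - ‖z‖ ^ 2)⁻¹) (Metric.ball 0 1) :=
    (contDiffOn_const.sub (contDiff_norm_sq ℝ).contDiffOn).inv h0
  have h2 : ∀ v : Cn m, ContDiff ℝ ω fun z : Cn m => euclid m z v := fun v =>
    (euclid m).contDiff.clm_apply contDiff_const
  have h3 : ∀ v : Cn m, ContDiff ℝ ω fun z : Cn m => euclid m (Complex.I • z) v := fun v =>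
    (h2 v).comp (contDiff_const_smul Complex.I)
  refine contDiffOn_clm_apply.2 fun v => contDiffOn_clm_apply.2 fun w => ?_
  exact (h1.mul contDiffOn_const).add ((h1.pow 2).mul
    (((h2 v).mul (h2 w)).add ((h3 v).mul (h3 w))).contDiffOn)

/-- The global chart trivializes the tangent bundle by the identity. -/
theorem symmL_trivializationAt (x y : CH m) (v : Cn m) :
    (trivializationAt (Cn m) (TangentSpace 𝓘(ℝ, Cn m)) x).symmL ℝ y v = v :=
  (congrArg (fun L : Cn m →L[ℝ] Cn m => L v)
    (TangentBundle.symmL_trivializationAt_eq_core (I := 𝓘(ℝ, Cn m)) (b₀ := x)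
      (mem_chart_source (Cn m) y))).trans
    ((tangentBundleCore 𝓘(ℝ, Cn m) (CH m)).coordChange_self (achart (Cn m) y) y
      (mem_chart_source (Cn m) y) v)

/-- The global chart trivializes the cotangent bundle by the identity. -/
theorem continuousLinearMapAt_dual (x y : CH m) (L : Cn m →L[ℝ] ℝ) (w : Cn m) :
    ((trivializationAt (Cn m →L[ℝ] ℝ)
      (fun z : CH m => TangentSpace 𝓘(ℝ, Cn m) z →L[ℝ] ℝ) x).continuousLinearMapAt ℝ y L :
        Cn m →L[ℝ] ℝ) w = L w := by
  have hy : y ∈ (trivializationAt (Cn m →L[ℝ] ℝ)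
      (fun z : CH m => TangentSpace 𝓘(ℝ, Cn m) z →L[ℝ] ℝ) x).baseSet :=
    ⟨mem_chart_source (Cn m) y, trivial⟩
  have h := congrFun (Bundle.Trivialization.coe_linearMapAt_of_mem (R := ℝ)
    (trivializationAt (Cn m →L[ℝ] ℝ)
      (fun z : CH m => TangentSpace 𝓘(ℝ, Cn m) z →L[ℝ] ℝ) x) hy) L
  refine (congrArg (fun F : Cn m →L[ℝ] ℝ => F w) h).trans ?_
  refine (congrArg (fun p : CH m × (Cn m →L[ℝ] ℝ) => p.2 w) (hom_trivializationAt_apply ..)).trans ?_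
  have h' := congrFun (Bundle.Trivialization.coe_linearMapAt_of_mem (R := ℝ)
    (trivializationAt ℝ (fun _ : CH m => ℝ) x) (Set.mem_univ y))
  exact (h' _).trans (congrArg L (symmL_trivializationAt x y w))

/-- The Bergman metric, as a real analytic Riemannian metric on the ball. The tangent spaces are
identified with `ℂ^m` through the global chart. -/
def metric (m : ℕ) : Bundle.ContMDiffRiemannianMetric 𝓘(ℝ, Cn m) ω (Cn m)
    (fun z : CH m => TangentSpace 𝓘(ℝ, Cn m) z) where
  inner z := metricAt z.val
  symm z v w := metricAt_symm z.val v w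
  pos z v hv := (pow_pos (norm_pos_iff.2 hv) 2).trans_le (metricAt_self z v)
  isVonNBounded z := by
    refine (NormedSpace.isVonNBounded_ball ℝ (Cn m) 1).subset fun v hv => ?_
    have h := (metricAt_self z v).trans_lt hv
    exact mem_ball_zero_iff.2 ((sq_lt_one_iff₀ (norm_nonneg (E := Cn m) v)).1 h)
  contMDiff := by
    intro x
    refine (Bundle.contMDiffAt_section _).2 ?_
    have h : ContMDiff 𝓘(ℝ, Cn m) 𝓘(ℝ, Cn m →L[ℝ] Cn m →L[ℝ] ℝ) ω
        (fun z : CH m => metricAt z.val) :=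
      contDiffOn_metricAt.contMDiffOn.comp_contMDiff (contMDiff_isOpenEmbedding isOpenEmbedding_val)
        fun z => mem_ball_zero_iff.2 (norm_val_lt_one z)
    refine (h x).congr_of_eventuallyEq (Filter.Eventually.of_forall fun y => ?_)
    refine (congrArg Prod.snd (hom_trivializationAt_apply ..)).trans ?_
    refine ContinuousLinearMap.ext fun v => ?_
    refine ContinuousLinearMap.ext fun w => (continuousLinearMapAt_dual x y _ w).trans ?_
    exact congrArg (fun u => metricAt y.val u w) (symmL_trivializationAt x y v)

instance : Bundle.RiemannianBundle
    (fun z : CH m => TangentSpace 𝓘(ℝ, Cn m) z) :=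
  ⟨(metric m).toRiemannianMetric⟩

open scoped Bundle in
instance (z : CH m) : NormedAddCommGroup (TangentSpace 𝓘(ℝ, Cn m) z) := inferInstance

open scoped Bundle in
instance (z : CH m) : InnerProductSpace ℝ (TangentSpace 𝓘(ℝ, Cn m) z) := inferInstance

instance (z : CH m) : FiniteDimensional ℝ (TangentSpace 𝓘(ℝ, Cn m) z) :=
  inferInstanceAs (FiniteDimensional ℝ (Cn m))

instance (z : CH m) : CompleteSpace (TangentSpace 𝓘(ℝ, Cn m) z) :=
  FiniteDimensional.complete ℝ _

/-- The Riemannian distance: the infimum of the lengths of `C^1` paths. -/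
def rdist (x y : CH m) : ℝ := (riemannianEDist 𝓘(ℝ, Cn m) x y).toReal

/-- The Gram matrix of the metric at `z` in the standard real frame. -/
def gram (z : CH m) : Matrix (Fin m × Fin 2) (Fin m × Fin 2) ℝ :=
  Matrix.of fun p q => metricAt z.val (Cn.frame p) (Cn.frame q)

/-- The Riemannian measure: density `√(det g)` with respect to Lebesgue measure. -/
def vol (m : ℕ) : Measure (CH m) :=
  (Measure.comap val volume).withDensity fun z => ENNReal.ofReal (Real.sqrt (gram z).det)

/-- The Riemannian gradient of a function, i.e. the vector representing the differential. -/
def grad (f : CH m → ℝ) (z : CH m) : TangentSpace 𝓘(ℝ, Cn m) z :=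
  (InnerProductSpace.toDual ℝ (TangentSpace 𝓘(ℝ, Cn m) z)).symm
    (mfderiv 𝓘(ℝ, Cn m) 𝓘(ℝ, ℝ) f z)

end CH

end

namespace CH

/-! The proof is a ground state argument. On geodesic spheres the volume density is proportional to
`sinh ρ ^ (2m-1) * cosh ρ`. Dividing `√ρ`, the ground state of the one-dimensional Hardy inequality,
by the square root of this density gives a positive function whose logarithmic gradient `X`
satisfies `div X + |X|² = -w` away from `x₀`, where `w` is the weight of the theorem. Expanding `|∇φ
- φ X|² ≥ 0` gives `w φ² ≤ |∇φ|² - div (φ² X)`, and the divergence integrates to zero.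

Everything is expressed through `F = cosh² ρ`, which is an explicit rational function on the ball
and smooth also at `x₀`. It satisfies `|∇F|² = 4F(F-1)` and `ΔF = 4(m+1)F - 4`, so that `X = κ(ρ)∇F`
turns the equation for `X` into an ordinary Riccati equation, `riccati_hardyField`.

The field `X` is singular at `x₀`, so `κ` is multiplied by a cutoff in `F`. Since `κ ≤ 0` and the
cutoff is nondecreasing with values in `[0, 1]`, the equation survives as an inequality in the
useful direction (`cutField_riccati_le`). Fatou's lemma removes the cutoff, and also yields
integrability of the weighted square.

The identity between `F` and the Riemannian distance is needed only as the inequality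
`arcoshSqrt_coshSq_le_rdist`: the weight is decreasing (`antitoneOn_hardyWeight`), so a lower bound
for the distance bounds the weight from above. -/

/-! ### Monotonicity and positivity of the radial weight -/

theorem cube_mul_cosh_le_sinh_cube {t : ℝ} (ht : 0 ≤ t) :
    t ^ 3 * Real.cosh t ≤ Real.sinh t ^ 3 := by
  have hd : ∀ x : ℝ, HasDerivAt (fun x => Real.sinh x * Real.cosh x ^ (-(1 / 3) : ℝ) - x)
      (Real.cosh x * Real.cosh x ^ (-(1 / 3) : ℝ) + Real.sinh x *
        (Real.sinh x * (-(1 / 3)) * Real.cosh x ^ ((-(1 / 3) : ℝ) - 1)) - 1) x := fun x =>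
    ((Real.hasDerivAt_sinh x).mul ((Real.hasDerivAt_cosh x).rpow_const
      (Or.inl (Real.cosh_pos x).ne'))).sub (hasDerivAt_id x)
  have hpow : ∀ x : ℝ, ∃ y : ℝ, 0 < y ∧ y ^ 3 = Real.cosh x ∧
      Real.cosh x ^ (-(1 / 3) : ℝ) = y⁻¹ := fun x => by
    have hc := Real.cosh_pos x
    refine ⟨Real.cosh x ^ (1 / 3 : ℝ), by positivity, ?_, Real.rpow_neg hc.le _⟩
    rw [← Real.rpow_natCast, ← Real.rpow_mul hc.le]
    norm_num
  have hm : Monotone (fun x => Real.sinh x * Real.cosh x ^ (-(1 / 3) : ℝ) - x) := by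
    refine monotone_of_deriv_nonneg (fun x => (hd x).differentiableAt) fun x => ?_
    rw [(hd x).deriv]
    obtain ⟨y, hy, hy3, hyi⟩ := hpow x
    rw [Real.rpow_sub_one (Real.cosh_pos x).ne', hyi, ← hy3]
    have hs : Real.sinh x * Real.sinh x = y ^ 6 - 1 := by
      have := Real.cosh_sq x
      rw [← hy3] at this
      linear_combination -this
    -- With `y = cosh x ^ (1/3)` the derivative has numerator `2y⁶ - 3y⁴ + 1`, which has the double
    -- root `y² = 1`.
    have : y ^ 3 * y⁻¹ + Real.sinh x * (Real.sinh x * (-(1 / 3)) * (y⁻¹ / y ^ 3)) - 1 =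
        (y ^ 2 - 1) ^ 2 * (2 * y ^ 2 + 1) / (3 * y ^ 4) := by
      rw [show Real.sinh x * (Real.sinh x * (-(1 / 3)) * (y⁻¹ / y ^ 3)) =
        (Real.sinh x * Real.sinh x) * (-(1 / 3)) * (y⁻¹ / y ^ 3) by ring, hs]
      field_simp
      ring
    rw [this]
    positivity
  have h0 := hm ht
  obtain ⟨y, hy, hy3, hyi⟩ := hpow t
  simp only [Real.sinh_zero, zero_mul, sub_zero, hyi] at h0
  have h1 : t * y ≤ Real.sinh t := by
    have : t ≤ Real.sinh t * y⁻¹ := by linarith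
    rwa [← div_eq_mul_inv, le_div_iff₀ hy] at this
  rw [← hy3, ← mul_pow]
  exact pow_le_pow_left₀ (by positivity) h1 3

/-- The derivative is `-2/t³ + 2 cosh t / sinh³ t`, whose sign is exactly
`cube_mul_cosh_le_sinh_cube`. -/
theorem antitoneOn_one_div_sq_sub_one_div_sinh_sq :
    AntitoneOn (fun t : ℝ => 1 / t ^ 2 - 1 / Real.sinh t ^ 2) (Set.Ioi 0) := by
  have hd : ∀ t ∈ Set.Ioi (0 : ℝ), HasDerivAt (fun t : ℝ => 1 / t ^ 2 - 1 / Real.sinh t ^ 2)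
      (-(2 / t ^ 3) + 2 * Real.cosh t / Real.sinh t ^ 3) t := fun t ht => by
    have ht' : t ≠ 0 := (Set.mem_Ioi.1 ht).ne'
    have hs : Real.sinh t ≠ 0 := (Real.sinh_pos_iff.2 ht).ne'
    have h1 := (hasDerivAt_pow 2 t).inv (pow_ne_zero 2 ht')
    have h2 := ((Real.hasDerivAt_sinh t).pow 2).inv (pow_ne_zero 2 hs)
    simp only [one_div]
    refine (h1.sub h2).congr_deriv ?_
    simp only [Nat.cast_ofNat, Pi.pow_apply]
    field_simp
    ring
  refine antitoneOn_of_deriv_nonpos (convex_Ioi 0)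
    (fun t ht => (hd t ht).continuousAt.continuousWithinAt)
    (fun t ht => (hd t (interior_subset ht)).differentiableAt.differentiableWithinAt)
    fun t ht => ?_
  have ht := interior_subset ht
  rw [(hd t ht).deriv]
  have ht' : 0 < t := ht
  have hs : 0 < Real.sinh t := Real.sinh_pos_iff.2 ht
  have := cube_mul_cosh_le_sinh_cube ht'.le
  rw [neg_add_nonpos_iff, div_le_div_iff₀ (by positivity) (by positivity)]
  linarith

/-- The Hardy weight of complex hyperbolic space, as a function of the distance. -/
noncomputable def hardyWeight (m : ℕ) (t : ℝ) : ℝ :=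
  (m : ℝ) ^ 2 + 1 / (4 * t ^ 2) + ((m : ℝ) - 1) ^ 2 / Real.sinh t ^ 2 - 1 / Real.sinh (2 * t) ^ 2

/-- The terms `1/(4t²)` and `-1/sinh²(2t)` are grouped: together they are the preceding function
evaluated at `2t`. -/
theorem antitoneOn_hardyWeight (m : ℕ) : AntitoneOn (hardyWeight m) (Set.Ioi 0) := by
  intro a ha b hb hab
  have ha' : 0 < a := ha
  have hb' : 0 < b := hb
  have h1 := antitoneOn_one_div_sq_sub_one_div_sinh_sq (a := 2 * a) (b := 2 * b)
    (by simpa using ha') (by simpa using hb') (by linarith)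
  have h2 : ((m : ℝ) - 1) ^ 2 / Real.sinh b ^ 2 ≤ ((m : ℝ) - 1) ^ 2 / Real.sinh a ^ 2 := by
    have := Real.sinh_pos_iff.2 ha'
    have := Real.sinh_le_sinh.2 hab
    gcongr
  simp only [mul_pow] at h1
  norm_num only at h1
  simp only [hardyWeight]
  linarith

theorem hardyWeight_sub_pos (m : ℕ) {t : ℝ} (ht : 0 < t) :
    0 < 1 / (4 * t ^ 2) + ((m : ℝ) - 1) ^ 2 / Real.sinh t ^ 2 - 1 / Real.sinh (2 * t) ^ 2 := by
  have h1 : 2 * t < Real.sinh (2 * t) := Real.self_lt_sinh_iff.2 (by linarith)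
  have h2 : 1 / Real.sinh (2 * t) ^ 2 < 1 / (4 * t ^ 2) := by
    rw [show 4 * t ^ 2 = (2 * t) ^ 2 by ring]
    gcongr
  have h3 : 0 ≤ ((m : ℝ) - 1) ^ 2 / Real.sinh t ^ 2 := by positivity
  linarith

theorem hardyWeight_nonneg (m : ℕ) {t : ℝ} (ht : 0 ≤ t) : 0 ≤ hardyWeight m t := by
  rcases ht.eq_or_lt with rfl | ht
  -- At `t = 0` every quotient is a division by zero with value `0`, leaving `m²`.
  · simp [hardyWeight]
  · have := hardyWeight_sub_pos m ht
    have := sq_nonneg (m : ℝ)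
    simp only [hardyWeight]
    linarith

/-! ### The ground state and its Riccati equation -/

/-- The coefficient of the logarithmic gradient of the ground state: with `F = cosh² ρ`, the
logarithmic gradient of `(ρ / (sinh ρ ^ (2 m - 1) * cosh ρ)) ^ (1 / 2)` is `hardyField m ρ • ∇F`. -/
noncomputable def hardyField (m : ℕ) (t : ℝ) : ℝ :=
  1 / (4 * t * (Real.sinh t * Real.cosh t)) - (2 * m - 1) / (4 * Real.sinh t ^ 2)
    - 1 / (4 * Real.cosh t ^ 2)

theorem hasDerivAt_hardyField (m : ℕ) {t : ℝ} (ht : 0 < t) :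
    HasDerivAt (hardyField m) (-((Real.sinh t * Real.cosh t + t * (Real.cosh t ^ 2
      + Real.sinh t ^ 2)) / (4 * (t * (Real.sinh t * Real.cosh t)) ^ 2))
      + (2 * m - 1) * Real.cosh t / (2 * Real.sinh t ^ 3)
      + Real.sinh t / (2 * Real.cosh t ^ 3)) t := by
  have hs : Real.sinh t ≠ 0 := (Real.sinh_pos_iff.2 ht).ne'
  have hc : Real.cosh t ≠ 0 := (Real.cosh_pos t).ne'
  have h1 := (((hasDerivAt_id t).const_mul 4).mul
    ((Real.hasDerivAt_sinh t).mul (Real.hasDerivAt_cosh t))).inv (by simp; grind)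
  have h2 := (((Real.hasDerivAt_sinh t).pow 2).const_mul 4).inv (by simp [hs])
  have h3 := (((Real.hasDerivAt_cosh t).pow 2).const_mul 4).inv (by simp [hc])
  have h := (h1.sub (h2.const_mul (2 * m - 1 : ℝ))).sub h3
  refine HasDerivAt.congr_deriv (f' := _) (h.congr_of_eventuallyEq
    (Filter.Eventually.of_forall fun x => ?_)) ?_
  · simp [hardyField, div_eq_mul_inv]
  · simp
    field_simp
    ring

/-- The Riccati equation of the ground state. -/
theorem riccati_hardyField (m : ℕ) {t : ℝ} (ht : 0 < t) :
    deriv (hardyField m) t * (2 * (Real.sinh t * Real.cosh t))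
      + hardyField m t * (4 * (m + 1) * Real.cosh t ^ 2 - 4)
      + hardyField m t ^ 2 * (4 * (Real.cosh t ^ 2 * (Real.cosh t ^ 2 - 1))) = -hardyWeight m t := by
  rw [(hasDerivAt_hardyField m ht).deriv, hardyField, hardyWeight, Real.sinh_two_mul]
  have hs : Real.sinh t ≠ 0 := (Real.sinh_pos_iff.2 ht).ne'
  have hc : Real.cosh t ≠ 0 := (Real.cosh_pos t).ne'
  have h := Real.cosh_sq t
  generalize Real.sinh t = s at *
  generalize Real.cosh t = c at *
  have hs' : s ^ 2 = c ^ 2 - 1 := by linarith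
  field_simp
  grind

/-- The first term is absorbed by the second because `tanh t ≤ t` and `2m - 1 ≥ 1`. This sign makes
the derivative of the cutoff harmless. -/
theorem hardyField_nonpos {m : ℕ} (hm : 1 ≤ m) {t : ℝ} (ht : 0 < t) : hardyField m t ≤ 0 := by
  have hs := Real.sinh_pos_iff.2 ht
  have hc := Real.cosh_pos t
  have hm' : (1 : ℝ) ≤ m := by exact_mod_cast hm
  have h : Real.sinh t ≤ t * Real.cosh t := by
    have hd : ∀ x : ℝ, HasDerivAt (fun x => x * Real.cosh x - Real.sinh x) (x * Real.sinh x) x :=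
      fun x => (((hasDerivAt_id x).mul (Real.hasDerivAt_cosh x)).sub
        (Real.hasDerivAt_sinh x)).congr_deriv (by simp)
    have hmono : MonotoneOn (fun x => x * Real.cosh x - Real.sinh x) (Set.Ici 0) :=
      monotoneOn_of_deriv_nonneg (convex_Ici 0) (fun x _ => (hd x).continuousAt.continuousWithinAt)
        (fun x _ => (hd x).differentiableAt.differentiableWithinAt) fun x hx => by
          have hx' : 0 ≤ x := interior_subset hx
          rw [(hd x).deriv]
          exact mul_nonneg hx' (Real.sinh_nonneg_iff.2 hx')
    have := hmono (a := 0) (b := t) (by simp) ht.le ht.le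
    simpa using this
  have h1 : 1 / (4 * t * (Real.sinh t * Real.cosh t)) ≤ (2 * m - 1) / (4 * Real.sinh t ^ 2) := by
    rw [div_le_div_iff₀ (by positivity) (by positivity)]
    have h3 : (0 : ℝ) ≤ t * Real.sinh t * Real.cosh t := by positivity
    nlinarith
  have h2 : 0 ≤ 1 / (4 * Real.cosh t ^ 2) := by positivity
  simp only [hardyField]
  linarith

/-! ### The variable `f = cosh² t` and the cutoff -/

/-- The inverse of `t ↦ cosh² t` on `[1, ∞)`. -/
noncomputable def arcoshSqrt (f : ℝ) : ℝ := Real.arsinh √(f - 1)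

theorem sinh_arcoshSqrt_sq {f : ℝ} (hf : 1 ≤ f) : Real.sinh (arcoshSqrt f) ^ 2 = f - 1 := by
  rw [arcoshSqrt, Real.sinh_arsinh, Real.sq_sqrt (by linarith)]

theorem cosh_arcoshSqrt_sq {f : ℝ} (hf : 1 ≤ f) : Real.cosh (arcoshSqrt f) ^ 2 = f := by
  rw [Real.cosh_sq, sinh_arcoshSqrt_sq hf]
  ring

theorem arcoshSqrt_pos {f : ℝ} (hf : 1 < f) : 0 < arcoshSqrt f :=
  Real.arsinh_pos_iff.2 (Real.sqrt_pos.2 (by linarith))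

theorem hasDerivAt_arcoshSqrt {f : ℝ} (hf : 1 < f) :
    HasDerivAt arcoshSqrt
      (1 / (2 * (Real.sinh (arcoshSqrt f) * Real.cosh (arcoshSqrt f)))) f := by
  have hc := Real.cosh_pos (arcoshSqrt f)
  have hs := Real.sinh_pos_iff.2 (arcoshSqrt_pos hf)
  have h1 : HasDerivAt (fun f : ℝ => √(f - 1)) (1 / (2 * √(f - 1))) f :=
    ((hasDerivAt_id f).sub_const 1).sqrt (by simp; linarith)
  refine h1.arsinh.congr_deriv ?_
  have e1 : √(f - 1) = Real.sinh (arcoshSqrt f) := by rw [arcoshSqrt, Real.sinh_arsinh]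
  rw [e1, add_comm, ← Real.cosh_sq, Real.sqrt_sq hc.le]
  simp only [smul_eq_mul]
  field_simp

/-- The coefficient `hardyField`, as a function of `cosh² ρ` and cut off near `ρ = 0`. -/
noncomputable def cutField (m n : ℕ) (f : ℝ) : ℝ :=
  Real.smoothTransition (n * (f - 1) - 1) * hardyField m (arcoshSqrt f)

/-- The shift by `-1` inside the cutoff makes it vanish until `n (f - 1)` reaches `1`, hence on a
full neighbourhood of the singular value `f = 1`. -/
theorem cutField_eventuallyEq_zero (m n : ℕ) {f : ℝ} (hf : f ≤ 1) :
    cutField m n =ᶠ[nhds f] fun _ => 0 := by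
  have : ContinuousAt (fun f : ℝ => n * (f - 1) - 1) f := by fun_prop
  have h0 : (n : ℝ) * (f - 1) - 1 < 0 := by
    have : (n : ℝ) * (f - 1) ≤ 0 :=
      mul_nonpos_of_nonneg_of_nonpos (Nat.cast_nonneg n) (by linarith)
    linarith
  filter_upwards [this.eventually_lt_const h0] with y hy
  rw [cutField, Real.smoothTransition.zero_of_nonpos hy.le, zero_mul]

theorem contDiffAt_hardyField_arcoshSqrt (m : ℕ) {f : ℝ} (hf : 1 < f) :
    ContDiffAt ℝ 1 (fun f => hardyField m (arcoshSqrt f)) f := by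
  have ht : arcoshSqrt f ≠ 0 := (arcoshSqrt_pos hf).ne'
  have hs : Real.sinh (arcoshSqrt f) ≠ 0 := (Real.sinh_pos_iff.2 (arcoshSqrt_pos hf)).ne'
  have hc : Real.cosh (arcoshSqrt f) ≠ 0 := (Real.cosh_pos _).ne'
  have hT : ContDiffAt ℝ 1 arcoshSqrt f :=
    ((contDiffAt_id.sub contDiffAt_const).sqrt (by simp; linarith)).arsinh
  have hsT : ContDiffAt ℝ 1 (fun f => Real.sinh (arcoshSqrt f)) f := hT.sinh
  have hcT : ContDiffAt ℝ 1 (fun f => Real.cosh (arcoshSqrt f)) f := hT.cosh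
  simp only [hardyField]
  refine ((contDiffAt_const.div ((contDiffAt_const.mul hT).mul (hsT.mul hcT)) ?_).sub
    (contDiffAt_const.div (contDiffAt_const.mul (hsT.pow 2)) ?_)).sub
    (contDiffAt_const.div (contDiffAt_const.mul (hcT.pow 2)) ?_)
  · simp [ht, hs, hc]
  · simp [hs]
  · simp [hc]

theorem contDiff_cutField (m n : ℕ) : ContDiff ℝ 1 (cutField m n) := by
  refine contDiff_iff_contDiffAt.2 fun f => ?_
  rcases le_or_gt f 1 with hf | hf
  · exact contDiffAt_const.congr_of_eventuallyEq (cutField_eventuallyEq_zero m n hf)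
  · have h1 : ContDiff ℝ 1 fun f : ℝ => Real.smoothTransition (n * (f - 1) - 1) :=
      Real.smoothTransition.contDiff.comp (by fun_prop)
    exact h1.contDiffAt.mul (contDiffAt_hardyField_arcoshSqrt m hf)

/-- With cutoff `χ` and coefficient `κ`, the left side is `χ` times the exact Riccati expression
plus two errors of the right sign: the term in `χ' κ ≤ 0`, and `(χ² - χ) κ² |∇F|² ≤ 0`. -/
theorem cutField_riccati_le {m : ℕ} (hm : 1 ≤ m) (n : ℕ) {f : ℝ} (hf : 1 ≤ f) :
    deriv (cutField m n) f * (4 * f * (f - 1)) + cutField m n f * (4 * (m + 1) * f - 4)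
      + cutField m n f ^ 2 * (4 * f * (f - 1))
      ≤ -(Real.smoothTransition (n * (f - 1) - 1) * hardyWeight m (arcoshSqrt f)) := by
  rcases hf.eq_or_lt with rfl | hf
  · have h := cutField_eventuallyEq_zero m n le_rfl
    rw [h.deriv_eq, h.self_of_nhds]
    simp [Real.smoothTransition.zero_of_nonpos]
  · have ht := arcoshSqrt_pos hf
    have hc2 := cosh_arcoshSqrt_sq hf.le
    have hc := Real.cosh_pos (arcoshSqrt f)
    have hs := Real.sinh_pos_iff.2 ht
    have hs2 := sinh_arcoshSqrt_sq hf.le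
    have hR := riccati_hardyField m ht
    have hk := hardyField_nonpos hm ht
    have hw := hardyWeight_nonneg m ht.le
    have hd1 : HasDerivAt (fun f : ℝ => Real.smoothTransition (n * (f - 1) - 1))
        (deriv Real.smoothTransition (n * (f - 1) - 1) * n) f := by
      have h0 : HasDerivAt (fun f : ℝ => (n : ℝ) * (f - 1) - 1) n f := by
        simpa using (((hasDerivAt_id f).sub_const 1).const_mul (n : ℝ)).sub_const 1
      exact (((Real.smoothTransition.contDiff (n := 1)).differentiable one_ne_zero
        (n * (f - 1) - 1)).hasDerivAt).comp f h0
    have hd2 := (hasDerivAt_hardyField m ht).differentiableAt.hasDerivAt.comp f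
      (hasDerivAt_arcoshSqrt hf)
    have hd : deriv (cutField m n) f = _ := (hd1.mul hd2).deriv
    have hχ' : 0 ≤ deriv Real.smoothTransition (n * (f - 1) - 1) :=
      Real.smoothTransition.monotone.deriv_nonneg
    have hχ0 := Real.smoothTransition.nonneg (n * (f - 1) - 1)
    have hχ1 := Real.smoothTransition.le_one (n * (f - 1) - 1)
    rw [hd]
    simp only [cutField, Function.comp_apply]
    rw [hc2] at hR
    generalize deriv Real.smoothTransition (n * (f - 1) - 1) = χ' at *
    generalize Real.smoothTransition (n * (f - 1) - 1) = χ at *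
    generalize deriv (hardyField m) (arcoshSqrt f) = κ' at *
    generalize hardyField m (arcoshSqrt f) = κ at *
    generalize hardyWeight m (arcoshSqrt f) = w at *
    generalize Real.sinh (arcoshSqrt f) = s at *
    generalize Real.cosh (arcoshSqrt f) = c at *
    -- Chain rule from `t` to `f = cosh² t`, using `4f(f-1) = (2sc)²`.
    have e : κ' * (1 / (2 * (s * c))) * (4 * f * (f - 1)) = κ' * (2 * (s * c)) := by
      rw [← hs2, ← hc2]
      field_simp
      ring
    have h1 : χ' * n * κ * (4 * f * (f - 1)) ≤ 0 :=
      mul_nonpos_of_nonpos_of_nonneg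
        (mul_nonpos_of_nonneg_of_nonpos (mul_nonneg hχ' (Nat.cast_nonneg n)) hk)
        (mul_nonneg (by linarith) (by linarith))
    have h2 : χ * (1 - χ) * (κ ^ 2 * (4 * f * (f - 1))) ≥ 0 :=
      mul_nonneg (mul_nonneg hχ0 (by linarith))
        (mul_nonneg (sq_nonneg _) (mul_nonneg (by linarith) (by linarith)))
    have : (χ' * n * κ + χ * (κ' * (1 / (2 * (s * c))))) * (4 * f * (f - 1))
        = χ' * n * κ * (4 * f * (f - 1)) + χ * (κ' * (2 * (s * c))) := by
      rw [← e]
      ring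
    rw [this]
    have h3 := congrArg (fun x => χ * x) hR
    nlinarith

/-! ### The function `F = cosh² ρ` on the ball, its gradient and divergence -/

variable {m : ℕ}

theorem one_sub_norm_sq_pos {z : Cn m} (hz : ‖z‖ < 1) : 0 < 1 - ‖z‖ ^ 2 := by
  nlinarith [norm_nonneg z]

/-- `cosh²` of the distance to `a`. -/
noncomputable def coshSq (a x : Cn m) : ℝ :=
  Complex.normSq (1 - inner ℂ a x) / ((1 - ‖x‖ ^ 2) * (1 - ‖a‖ ^ 2))

/-- The Riemannian gradient of `coshSq a`. -/
noncomputable def gradCoshSq (a x : Cn m) : Cn m :=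
  (((2 / (1 - ‖a‖ ^ 2) : ℝ) : ℂ) * (1 - inner ℂ a x)) • (x - a)

theorem inner_self_complex (x : Cn m) : inner ℂ x x = ((‖x‖ ^ 2 : ℝ) : ℂ) := by
  rw [inner_self_eq_norm_sq_to_K]
  norm_cast

/-- The right side is the differential of `coshSq a` at `x` applied to `v`; this is what justifies
calling `gradCoshSq` a gradient. -/
theorem metricAt_gradCoshSq {a x : Cn m} (ha : ‖a‖ < 1) (hx : ‖x‖ < 1) (v : Cn m) :
    metricAt x (gradCoshSq a x) v =
      2 / (1 - ‖a‖ ^ 2) * (Complex.normSq (1 - inner ℂ a x) * (inner ℂ x v).re / (1 - ‖x‖ ^ 2) ^ 2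
        - ((starRingEnd ℂ (1 - inner ℂ a x)) * inner ℂ a v).re / (1 - ‖x‖ ^ 2)) := by
  have ha' := (one_sub_norm_sq_pos ha).ne'
  have hx' := (one_sub_norm_sq_pos hx).ne'
  rw [metricAt_apply, gradCoshSq]
  simp only [inner_smul_left, inner_sub_left, inner_self_complex]
  generalize inner ℂ a v = p
  generalize inner ℂ a x = q
  generalize inner ℂ x v = r
  generalize 2 / (1 - ‖a‖ ^ 2) = k
  generalize ‖x‖ ^ 2 = s at *
  simp [Complex.normSq_apply]
  field_simp
  ring

theorem metricAt_gradCoshSq_self {a x : Cn m} (ha : ‖a‖ < 1) (hx : ‖x‖ < 1) :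
    metricAt x (gradCoshSq a x) (gradCoshSq a x) = 4 * coshSq a x * (coshSq a x - 1) := by
  have ha' := (one_sub_norm_sq_pos ha).ne'
  have hx' := (one_sub_norm_sq_pos hx).ne'
  rw [metricAt_gradCoshSq ha hx, gradCoshSq, coshSq]
  have h : inner ℂ x a = (starRingEnd ℂ) (inner ℂ a x) := (inner_conj_symm x a).symm
  simp only [inner_smul_right, inner_sub_right, inner_self_complex, h]
  generalize inner ℂ a x = q
  generalize ‖x‖ ^ 2 = s at *
  generalize ‖a‖ ^ 2 = c at *
  generalize hk : 2 / (1 - c) = k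
  simp [Complex.normSq_apply]
  rw [← hk]
  field_simp
  ring

theorem coshSq_pos {a x : Cn m} (ha : ‖a‖ < 1) (hx : ‖x‖ < 1) : 0 < coshSq a x := by
  have ha' := one_sub_norm_sq_pos ha
  have hx' := one_sub_norm_sq_pos hx
  have h : 1 - inner ℂ a x ≠ 0 := fun h => by
    have h1 : inner ℂ a x = 1 := (sub_eq_zero.1 h).symm
    have h2 := norm_inner_le_norm (𝕜 := ℂ) a x
    rw [h1, norm_one] at h2
    nlinarith [norm_nonneg a, norm_nonneg x]
  have := Complex.normSq_pos.2 h
  unfold coshSq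
  positivity

/-- The gradient vanishes only at `a`, so `4F(F-1) = |∇F|² > 0` elsewhere, and `F > 0` forces `F >
1`. -/
theorem one_lt_coshSq {a x : Cn m} (ha : ‖a‖ < 1) (hx : ‖x‖ < 1) (h : x ≠ a) :
    1 < coshSq a x := by
  have hF := coshSq_pos ha hx
  have hY : gradCoshSq a x ≠ 0 := by
    refine smul_ne_zero (mul_ne_zero ?_ fun h0 => ?_) (sub_ne_zero.2 h)
    · exact_mod_cast (div_pos two_pos (one_sub_norm_sq_pos ha)).ne'
    · rw [coshSq, h0] at hF
      simp at hF
  have h1 : 0 < 4 * coshSq a x * (coshSq a x - 1) := by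
    rw [← metricAt_gradCoshSq_self ha hx]
    exact (pow_pos (norm_pos_iff.2 hY) 2).trans_le
      (metricAt_self ⟨x, mem_ball_zero_iff.2 hx⟩ _)
  have := pos_of_mul_pos_right h1 (by positivity)
  linarith

theorem coshSq_self {a : Cn m} (ha : ‖a‖ < 1) : coshSq a a = 1 := by
  have ha' := (one_sub_norm_sq_pos ha).ne'
  rw [coshSq, inner_self_complex, ← Complex.ofReal_one, ← Complex.ofReal_sub,
    Complex.normSq_ofReal]
  exact div_self (mul_ne_zero ha' ha')

theorem one_le_coshSq {a x : Cn m} (ha : ‖a‖ < 1) (hx : ‖x‖ < 1) : 1 ≤ coshSq a x := by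
  rcases eq_or_ne x a with rfl | h
  · exact (coshSq_self ha).ge
  · exact (one_lt_coshSq ha hx h).le

/-- The complex-valued, real-linear functional `⟨a, ·⟩`. -/
noncomputable def innerReal (a : Cn m) : Cn m →L[ℝ] ℂ := (innerSL ℂ a).restrictScalars ℝ

@[simp] theorem innerReal_apply (a x : Cn m) : innerReal a x = inner ℂ a x := rfl

theorem hasFDerivAt_coshSq {a x : Cn m} (ha : ‖a‖ < 1) (hx : ‖x‖ < 1) :
    HasFDerivAt (coshSq a) (metricAt x (gradCoshSq a x)) x := by
  have ha' := (one_sub_norm_sq_pos ha).ne'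
  have hx' := (one_sub_norm_sq_pos hx).ne'
  have h1 : HasFDerivAt (fun x : Cn m => 1 - inner ℂ a x) (-innerReal a) x :=
    ((innerReal a).hasFDerivAt (x := x)).const_sub 1
  have hre := Complex.reCLM.hasFDerivAt.comp x h1
  have him := Complex.imCLM.hasFDerivAt.comp x h1
  have hs : HasFDerivAt (fun x : Cn m => (1 - ‖x‖ ^ 2) * (1 - ‖a‖ ^ 2)) _ x :=
    ((hasStrictFDerivAt_norm_sq x).hasFDerivAt.const_sub 1).mul_const _
  have h := ((hre.mul hre).add (him.mul him)).mul
    ((hasDerivAt_inv (mul_ne_zero hx' ha')).comp_hasFDerivAt x hs)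
  refine HasFDerivAt.congr_fderiv (f' := _) (h.congr_of_eventuallyEq
    (Filter.Eventually.of_forall fun y => ?_)) ?_
  · simp [coshSq, Complex.normSq_apply, div_eq_mul_inv]
  · ext v
    rw [metricAt_gradCoshSq ha hx]
    have hr : inner ℝ x v = (inner ℂ x v).re := rfl
    simp [Complex.normSq_apply, hr, -inner_conj_symm]
    field_simp
    ring

theorem contDiffOn_coshSq {a : Cn m} (ha : ‖a‖ < 1) :
    ContDiffOn ℝ ∞ (coshSq a) (Metric.ball 0 1) := by
  have ha' := (one_sub_norm_sq_pos ha).ne'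
  have h1 : ContDiff ℝ ∞ (fun x : Cn m => 1 - inner ℂ a x) :=
    contDiff_const.sub (innerReal a).contDiff
  have hre := Complex.reCLM.contDiff.comp h1
  have him := Complex.imCLM.contDiff.comp h1
  have hs : ContDiff ℝ ∞ (fun x : Cn m => (1 - ‖x‖ ^ 2) * (1 - ‖a‖ ^ 2)) :=
    (contDiff_const.sub (contDiff_norm_sq ℝ)).mul contDiff_const
  refine ((hre.mul hre).add (him.mul him)).contDiffOn.div hs.contDiffOn fun x hx => ?_
  exact mul_ne_zero (one_sub_norm_sq_pos (mem_ball_zero_iff.1 hx)).ne' ha'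

/-- The Euclidean derivative of `gradCoshSq a`. -/
noncomputable def fderivGradCoshSq (a x : Cn m) : Cn m →L[ℝ] Cn m :=
  (((2 / (1 - ‖a‖ ^ 2) : ℝ) : ℂ) * (1 - inner ℂ a x)) • ContinuousLinearMap.id ℝ (Cn m)
    + ((((2 / (1 - ‖a‖ ^ 2) : ℝ) : ℂ) • (-innerReal a)).smulRight (x - a))

theorem hasFDerivAt_gradCoshSq (a x : Cn m) :
    HasFDerivAt (gradCoshSq a) (fderivGradCoshSq a x) x := by
  have h1 : HasFDerivAt (fun x : Cn m => 1 - inner ℂ a x) (-innerReal a) x :=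
    ((innerReal a).hasFDerivAt (x := x)).const_sub 1
  exact (h1.const_mul _).smul ((hasFDerivAt_id x).sub_const a)

/-- The Euclidean divergence of `gradCoshSq a`. -/
theorem sum_inner_fderivGradCoshSq {a : Cn m} (ha : ‖a‖ < 1) (x : Cn m) {ι : Type*} [Fintype ι]
    (b : OrthonormalBasis ι ℝ (Cn m)) :
    ∑ i, inner ℝ (b i) (fderivGradCoshSq a x (b i)) =
      2 / (1 - ‖a‖ ^ 2) * (2 * (m + 1) * (1 - inner ℂ a x).re) - 4 := by
  have ha' := (one_sub_norm_sq_pos ha).ne'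
  have hcard : (Fintype.card ι : ℝ) = 2 * m := by
    rw [← Module.finrank_eq_card_basis b.toBasis, finrank_real_of_complex,
      show Module.finrank ℂ (Cn m) = m from finrank_euclideanSpace_fin]
    push_cast
    ring
  have hre : ∀ u v : Cn m, inner ℝ u v = (inner ℂ u v).re := fun _ _ => rfl
  have him : ∀ u v : Cn m, inner ℝ (Complex.I • u) v = (inner ℂ u v).im := fun u v => by
    rw [hre, inner_smul_left]
    simp
  have hflip : ∀ u v : Cn m, inner ℂ u v = (starRingEnd ℂ) (inner ℂ v u) := fun u v =>
    (inner_conj_symm u v).symm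
  -- Splitting `⟨a, b i⟩` into real and imaginary parts gives products of real inner products, each
  -- of which sums by Parseval.
  have h1 : ∀ i, inner ℝ (b i) (fderivGradCoshSq a x (b i)) =
      2 / (1 - ‖a‖ ^ 2) * ((1 - inner ℂ a x).re - (inner ℝ a (b i) * inner ℝ (b i) (x - a)
        + inner ℝ (Complex.I • a) (b i) * inner ℝ (b i) (Complex.I • (x - a)))) := fun i => by
    have hb : inner ℂ (b i) (b i) = 1 := by
      rw [inner_self_complex, b.norm_eq_one]
      simp
    rw [real_inner_comm (Complex.I • (x - a)) (b i), him, him, hre, hre, hre]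
    simp only [fderivGradCoshSq, add_apply, smul_apply, ContinuousLinearMap.smulRight_apply,
      ContinuousLinearMap.id_apply, neg_apply, innerReal_apply, inner_add_right,
      inner_smul_right, hb, hflip (x - a) (b i)]
    generalize 2 / (1 - ‖a‖ ^ 2) = k
    simp [-inner_conj_symm, inner_sub_right]
    ring
  simp_rw [h1]
  rw [← Finset.mul_sum, Finset.sum_sub_distrib, Finset.sum_add_distrib, b.sum_inner_mul_inner,
    b.sum_inner_mul_inner, Finset.sum_const, Finset.card_univ, nsmul_eq_mul, hcard, him,
    inner_smul_right, hre, inner_sub_right, inner_self_complex]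
  simp only [Complex.sub_re, Complex.one_re, Complex.mul_im, Complex.I_re, Complex.I_im,
    Complex.ofReal_re, Complex.sub_im, Complex.ofReal_im]
  field_simp
  ring

/-! ### The Riemannian volume density -/

/-- The `k`-th complex coordinate. -/
def coord (z : Cn m) (k : Fin m) : ℂ := (id z : EuclideanSpace ℂ (Fin m)).ofLp k

theorem euclid_frame_zero (z : Cn m) (k : Fin m) :
    euclid m z (Cn.frame (k, 0)) = (coord z k).re := by
  rw [euclid_apply]
  have := EuclideanSpace.inner_single_right k (1 : ℂ) (id z : EuclideanSpace ℂ (Fin m))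
  refine (congrArg Complex.re this).trans ?_
  simp [coord]

theorem euclid_frame_one (z : Cn m) (k : Fin m) :
    euclid m z (Cn.frame (k, 1)) = (coord z k).im := by
  rw [euclid_apply]
  have := EuclideanSpace.inner_single_right k (Complex.I : ℂ) (id z : EuclideanSpace ℂ (Fin m))
  refine (congrArg Complex.re this).trans ?_
  simp [coord]

theorem sum_euclid_frame_mul (z w : Cn m) :
    ∑ p, euclid m z (Cn.frame p) * euclid m w (Cn.frame p) = euclid m z w := by
  rw [Fintype.sum_prod_type]
  simp only [Fin.sum_univ_two, euclid_frame_zero, euclid_frame_one]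
  have : inner ℂ z w = ∑ k, inner ℂ (coord z k) (coord w k) := PiLp.inner_apply _ _
  rw [euclid_apply, this, Complex.re_sum]
  refine Finset.sum_congr rfl fun k _ => ?_
  simp [mul_comm]

theorem euclid_frame_frame (p q : Fin m × Fin 2) :
    euclid m (Cn.frame p) (Cn.frame q) = if p = q then 1 else 0 := by
  obtain ⟨k, i⟩ := p
  obtain ⟨l, j⟩ := q
  have h : coord (Cn.frame (k, i)) l = if l = k then (![1, Complex.I] i) else 0 :=
    PiLp.single_apply 2 ℂ k (![1, Complex.I] i) l
  fin_cases j
  · refine (euclid_frame_zero _ l).trans ?_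
    rw [h]
    simp only [Prod.mk.injEq, eq_comm (a := k)]
    fin_cases i <;> by_cases hkl : l = k <;> simp [hkl]
  · refine (euclid_frame_one _ l).trans ?_
    rw [h]
    simp only [Prod.mk.injEq, eq_comm (a := k)]
    fin_cases i <;> by_cases hkl : l = k <;> simp [hkl]

/-- The Gram matrix is `s (1 + s U Uᵀ)`, where `U` has the two columns `z` and `i z`. Sylvester's
identity reduces the determinant to a 2 × 2 one, equal to `s²` because the columns are orthogonal of
equal length; the outer scalar contributes `s ^ (2m)`. -/
theorem det_gram (z : CH m) : (gram z).det = ((1 - ‖z.val‖ ^ 2)⁻¹ ^ (m + 1)) ^ 2 := by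
  have hs := (one_sub_norm_sq_pos z.norm_val_lt_one).ne'
  set s := (1 - ‖z.val‖ ^ 2)⁻¹ with hsdef
  let U : Matrix (Fin m × Fin 2) (Fin 2) ℝ := Matrix.of fun p j =>
    euclid m (![z.val, Complex.I • z.val] j) (Cn.frame p)
  have hg : gram z = s • (1 + U * (s • U.transpose)) := by
    ext p q
    simp [gram, metricAt, Matrix.mul_apply, U, Matrix.one_apply, ← hsdef, euclid_frame_frame,
      -mul_ite]
    ring
  have hU : s • U.transpose * U = (s * ‖z.val‖ ^ 2) • (1 : Matrix (Fin 2) (Fin 2) ℝ) := by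
    have h00 : euclid m z.val z.val = ‖z.val‖ ^ 2 := by
      rw [euclid_apply, inner_self_complex, Complex.ofReal_re]
    have h11 : euclid m (Complex.I • z.val) (Complex.I • z.val) = ‖z.val‖ ^ 2 := by
      rw [euclid_apply, inner_self_complex, Complex.ofReal_re, norm_smul, Complex.norm_I, one_mul]
    have h01 : euclid m z.val (Complex.I • z.val) = 0 := by
      rw [euclid_apply, inner_smul_right, inner_self_complex]
      simp [-Complex.ofReal_pow]
    have h10 : euclid m (Complex.I • z.val) z.val = 0 := by
      rw [euclid_apply, inner_smul_left, inner_self_complex]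
      simp [-Complex.ofReal_pow]
    ext i j
    rw [Matrix.smul_mul, Matrix.smul_apply, Matrix.mul_apply]
    simp only [U, Matrix.transpose_apply, Matrix.of_apply, sum_euclid_frame_mul]
    fin_cases i <;> fin_cases j <;> simp [h00, h11, h01, h10]
  rw [hg, Matrix.det_smul, Matrix.det_one_add_mul_comm, hU]
  have h1 : (1 : Matrix (Fin 2) (Fin 2) ℝ) + (s * ‖z.val‖ ^ 2) • (1 : Matrix (Fin 2) (Fin 2) ℝ) =
      s • 1 := by
    have h2 : s = 1 + s * ‖z.val‖ ^ 2 := by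
      rw [hsdef]
      field_simp
      ring
    conv_rhs => rw [h2, add_smul, one_smul]
  rw [h1, Matrix.det_smul]
  simp
  ring

theorem sqrt_det_gram (z : CH m) : √(gram z).det = (1 - ‖z.val‖ ^ 2)⁻¹ ^ (m + 1) := by
  have hs := one_sub_norm_sq_pos z.norm_val_lt_one
  rw [det_gram, Real.sqrt_sq (by positivity)]

/-! ### Differentials in the global chart and the Riemannian distance -/

theorem hasMFDerivAt_val (z : CH m) :
    HasMFDerivAt 𝓘(ℝ, Cn m) 𝓘(ℝ, Cn m) (val : CH m → Cn m) z
      (ContinuousLinearMap.id ℝ (Cn m)) := by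
  refine ⟨isOpenEmbedding_val.continuous.continuousAt, ?_⟩
  have h : ∀ y ∈ Metric.ball (0 : Cn m) 1,
      writtenInExtChartAt 𝓘(ℝ, Cn m) 𝓘(ℝ, Cn m) z (val : CH m → Cn m) y = y := fun y hy =>
    isOpenEmbedding_val.toOpenPartialHomeomorph_right_inv _ ⟨⟨y, hy⟩, rfl⟩
  have hz : z.val ∈ Metric.ball (0 : Cn m) 1 := z.2
  exact (hasFDerivWithinAt_id (𝕜 := ℝ) (E := Cn m) _ _).congr_of_eventuallyEq
    (Filter.eventuallyEq_of_mem
      (mem_nhdsWithin_of_mem_nhds (Metric.isOpen_ball.mem_nhds hz)) h) (h _ hz)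

theorem mfderiv_comp_val {g : Cn m → ℝ} (z : CH m) (hg : DifferentiableAt ℝ g z.val) :
    mfderiv 𝓘(ℝ, Cn m) 𝓘(ℝ, ℝ) (fun z : CH m => g z.val) z = fderiv ℝ g z.val :=
  (hg.hasFDerivAt.hasMFDerivAt.comp z (hasMFDerivAt_val z)).mfderiv

theorem contMDiff_comp_val {n : ℕ∞} {g : Cn m → ℝ} (hg : ContDiffOn ℝ n g (Metric.ball 0 1)) :
    ContMDiff 𝓘(ℝ, Cn m) 𝓘(ℝ, ℝ) n fun z : CH m => g z.val :=
  hg.contMDiffOn.comp_contMDiff (contMDiff_isOpenEmbedding isOpenEmbedding_val) fun z => z.2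

theorem norm_tangent_sq (z : CH m) (v : TangentSpace 𝓘(ℝ, Cn m) z) :
    ‖v‖ ^ 2 = metricAt z.val v v :=
  (real_inner_self_eq_norm_sq v).symm

theorem sq_metricAt_le (z : CH m) (v w : Cn m) :
    metricAt z.val v w ^ 2 ≤ metricAt z.val v v * metricAt z.val w w := by
  have h : ∀ v w : TangentSpace 𝓘(ℝ, Cn m) z,
      (inner ℝ v w) ^ 2 ≤ (inner ℝ v v) * (inner ℝ w w) := fun v w => by
    rw [sq]
    exact real_inner_mul_inner_self_le v w
  exact h v w

-- A function with differential of norm at most one shortens paths: the length of `g ∘ γ` in `ℝ` is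
-- at most that of `γ`.
open scoped Bundle in
theorem edist_le_riemannianEDist {g : Cn m → ℝ} (hg : ContDiffOn ℝ 1 g (Metric.ball 0 1))
    (h : ∀ (z : CH m) (v : TangentSpace 𝓘(ℝ, Cn m) z), |fderiv ℝ g z.val v| ≤ ‖v‖) (x y : CH m) :
    edist (g x.val) (g y.val) ≤ riemannianEDist 𝓘(ℝ, Cn m) x y := by
  refine le_of_forall_gt fun r hr => ?_
  obtain ⟨γ, hγ0, hγ1, hγ, hlt⟩ := exists_lt_of_riemannianEDist_lt hr
  refine lt_of_le_of_lt ?_ hlt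
  rw [IsRiemannianManifold.out (I := 𝓘(ℝ, ℝ)) (g x.val) (g y.val)]
  refine (riemannianEDist_le_pathELength (γ := fun t => g (γ t).val) (a := 0) (b := 1)
    ((contMDiff_comp_val (n := 1) hg).comp_contMDiffOn hγ) (by simp [hγ0]) (by simp [hγ1])
    zero_le_one).trans ?_
  rw [pathELength_eq_lintegral_mfderiv_Ioo, pathELength_eq_lintegral_mfderiv_Ioo]
  refine setLIntegral_mono' measurableSet_Ioo fun t ht => ?_
  have hd : DifferentiableAt ℝ g (γ t).val :=
    (hg.differentiableOn one_ne_zero).differentiableAt (Metric.isOpen_ball.mem_nhds (γ t).2)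
  have hγt : MDifferentiableAt 𝓘(ℝ, ℝ) 𝓘(ℝ, Cn m) γ t :=
    (hγ.mdifferentiableOn one_ne_zero t ⟨ht.1.le, ht.2.le⟩).mdifferentiableAt
      (Icc_mem_nhds ht.1 ht.2)
  have hcomp := ((hd.hasFDerivAt.hasMFDerivAt.comp (γ t) (hasMFDerivAt_val (γ t))).comp t
    hγt.hasMFDerivAt).mfderiv
  have key := h (γ t) (mfderiv 𝓘(ℝ, ℝ) 𝓘(ℝ, Cn m) γ t 1)
  rw [enorm_tangentSpace_vectorSpace]
  have e : (mfderiv 𝓘(ℝ, ℝ) 𝓘(ℝ, ℝ) (fun t => g (γ t).val) t 1 : ℝ) =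
      fderiv ℝ g (γ t).val (mfderiv 𝓘(ℝ, ℝ) 𝓘(ℝ, Cn m) γ t 1) :=
    congrArg (fun L : ℝ →L[ℝ] ℝ => L 1) hcomp
  refine (congrArg (fun r : ℝ => ‖r‖ₑ) e).trans_le ?_
  rw [← ofReal_norm, ← ofReal_norm]
  exact ENNReal.ofReal_le_ofReal key

instance : IsContinuousRiemannianBundle (Cn m)
    (fun z : CH m => TangentSpace 𝓘(ℝ, Cn m) z) :=
  ⟨(metric m).inner, (metric m).contMDiff.continuous, fun _ _ _ => rfl⟩

open scoped Bundle in
theorem continuous_riemannianEDist (x₀ : CH m) :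
    Continuous fun x => riemannianEDist 𝓘(ℝ, Cn m) x x₀ := by
  have : RegularSpace (CH m) := inferInstanceAs (RegularSpace (Metric.ball (0 : Cn m) 1))
  have : IsManifold 𝓘(ℝ, Cn m) 1 (CH m) := .of_le (n := ω) le_top
  let : PseudoEMetricSpace (CH m) := .ofRiemannianMetric 𝓘(ℝ, Cn m) (CH m)
  exact continuous_id.edist continuous_const

/-- The set of points at finite distance from `x₀` is clopen and the ball is connected. Finiteness
matters because `rdist` is a `toReal`, which would send `⊤` to `0`. -/
theorem riemannianEDist_ne_top (x x₀ : CH m) : riemannianEDist 𝓘(ℝ, Cn m) x x₀ ≠ ⊤ := by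
  have : PreconnectedSpace (CH m) :=
    isPreconnected_iff_preconnectedSpace.1 (convex_ball (0 : Cn m) 1).isPreconnected
  have : RegularSpace (CH m) := inferInstanceAs (RegularSpace (Metric.ball (0 : Cn m) 1))
  have : IsManifold 𝓘(ℝ, Cn m) 1 (CH m) := .of_le (n := ω) le_top
  let : PseudoEMetricSpace (CH m) := .ofRiemannianMetric 𝓘(ℝ, Cn m) (CH m)
  have hcl : IsClopen (Metric.eball x₀ ⊤) :=
    ⟨Metric.isClosed_eball_top, Metric.isOpen_eball⟩
  have : x ∈ Metric.eball x₀ ⊤ := by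
    rw [hcl.eq_univ ⟨x₀, Metric.mem_eball_self (by simp)⟩]
    trivial
  exact (Metric.mem_eball.1 this).ne

theorem measurable_rdist (x₀ : CH m) : Measurable fun x => rdist x x₀ :=
  (continuous_riemannianEDist x₀).measurable.ennreal_toReal

/-- `arcoshSqrt ∘ coshSq`, smoothed near the centre. -/
theorem abs_fderiv_arsinh_le {a : Cn m} (ha : ‖a‖ < 1) {ε : ℝ} (hε : 0 < ε) (z : CH m)
    (v : TangentSpace 𝓘(ℝ, Cn m) z) :
    |fderiv ℝ (fun x => Real.arsinh √(coshSq a x - 1 + ε)) z.val v| ≤ ‖v‖ := by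
  have hz := z.norm_val_lt_one
  have hF1 := one_le_coshSq ha hz
  have h1 := ((((hasFDerivAt_coshSq ha hz).sub_const 1).add_const ε).sqrt (by linarith)).arsinh
  rw [h1.fderiv]
  -- Cauchy–Schwarz gives `dF(v)² ≤ 4F(F-1)|v|²`, to be compared with the factor `4(F-1+ε)(F+ε)`
  -- from the derivative of `arsinh √(F-1+ε)`.
  have hcs := sq_metricAt_le z (gradCoshSq a z.val) v
  rw [metricAt_gradCoshSq_self ha hz, ← norm_tangent_sq] at hcs
  refine abs_le_of_sq_le_sq ?_ (norm_nonneg v)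
  change ((√(1 + √(coshSq a z.val - 1 + ε) ^ 2))⁻¹ * (1 / (2 * √(coshSq a z.val - 1 + ε)) *
    metricAt z.val (gradCoshSq a z.val) v)) ^ 2 ≤ ‖v‖ ^ 2
  have hE : 0 < coshSq a z.val - 1 + ε := by linarith
  rw [mul_pow, mul_pow, inv_pow, Real.sq_sqrt hE.le, Real.sq_sqrt (by linarith), div_pow, mul_pow,
    Real.sq_sqrt hE.le, ← mul_assoc, ← div_eq_inv_mul, div_div, one_pow, one_div_mul_eq_div,
    div_le_iff₀ (by nlinarith)]
  refine hcs.trans ?_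
  rw [mul_comm]
  refine mul_le_mul_of_nonneg_left ?_ (sq_nonneg _)
  nlinarith

/-- The function `arsinh √(F-1)` has gradient of norm one but is not differentiable at `x₀`. Its
regularization with `F - 1 + ε` is smooth and 1-Lipschitz, and `ε → 0` gives the bound. -/
theorem arcoshSqrt_coshSq_le_rdist (x x₀ : CH m) :
    arcoshSqrt (coshSq x₀.val x.val) ≤ rdist x x₀ := by
  have ha := x₀.norm_val_lt_one
  have hstep : ∀ ε : ℝ, 0 < ε → Real.arsinh √(coshSq x₀.val x.val - 1 + ε) - Real.arsinh √ε ≤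
      rdist x x₀ := fun ε hε => by
    have hc : ContDiffOn ℝ 1 (fun x => Real.arsinh √(coshSq x₀.val x - 1 + ε))
        (Metric.ball 0 1) := by
      refine (((((contDiffOn_coshSq ha).of_le (by simp)).sub contDiffOn_const).add
        contDiffOn_const).sqrt fun y hy => ?_).arsinh
      have := one_le_coshSq ha (mem_ball_zero_iff.1 hy)
      linarith
    have h := edist_le_riemannianEDist hc (fun z v => abs_fderiv_arsinh_le ha hε z v) x x₀
    have h2 := ENNReal.toReal_mono (riemannianEDist_ne_top x x₀) h
    rw [edist_dist, ENNReal.toReal_ofReal dist_nonneg, Real.dist_eq, coshSq_self ha] at h2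
    simp only [sub_self, zero_add] at h2
    exact (le_abs_self _).trans h2
  have hlim : Filter.Tendsto (fun ε : ℝ => Real.arsinh √(coshSq x₀.val x.val - 1 + ε) -
      Real.arsinh √ε) (nhdsWithin 0 (Set.Ioi 0)) (nhds (arcoshSqrt (coshSq x₀.val x.val))) := by
    have hcont : Continuous fun ε : ℝ => Real.arsinh √(coshSq x₀.val x.val - 1 + ε) -
      Real.arsinh √ε :=
      (Real.continuous_arsinh.comp (by fun_prop)).sub (Real.continuous_arsinh.comp (by fun_prop))
    have := hcont.tendsto 0
    simp only [add_zero, Real.sqrt_zero, Real.arsinh_zero, sub_zero] at this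
    exact this.mono_left nhdsWithin_le_nhds
  exact le_of_tendsto hlim (eventually_mem_nhdsWithin.mono fun ε hε => hstep ε hε)

/-! ### The divergence theorem and integration against the Riemannian measure -/

theorem integrable_of_continuous_of_support {E : Type*} [NormedAddCommGroup E]
    [InnerProductSpace ℝ E] [FiniteDimensional ℝ E] [MeasurableSpace E] [BorelSpace E]
    {h u : E → ℝ} (hh : Continuous h) (hu : HasCompactSupport u)
    (hs : ∀ x, u x = 0 → h x = 0) : Integrable h :=
  hh.integrable_of_hasCompactSupport (hu.mono fun x hx hx' => hx (hs x hx'))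

/-- The divergence theorem for a compactly supported multiple of a vector field. -/
theorem integral_divergence_eq_zero {E : Type*} [NormedAddCommGroup E]
    [InnerProductSpace ℝ E] [FiniteDimensional ℝ E] [MeasurableSpace E] [BorelSpace E]
    {ι : Type*} [Fintype ι] (b : OrthonormalBasis ι ℝ E) {u : E → ℝ} (hu : ContDiff ℝ 1 u)
    (hc : HasCompactSupport u) {Y : E → E} (hY : ContDiff ℝ 1 Y) :
    ∫ x, (fderiv ℝ u x (Y x) + u x * ∑ i, inner ℝ (b i) (fderiv ℝ Y x (b i))) = 0 := by
  have hdu : Continuous (fderiv ℝ u) := hu.continuous_fderiv one_ne_zero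
  have hdY : Continuous (fderiv ℝ Y) := hY.continuous_fderiv one_ne_zero
  have hcd : ∀ v, HasCompactSupport fun x => fderiv ℝ u x v := fun v => hc.fderiv_apply ℝ v
  have hfd : ∀ i x, fderiv ℝ (fun x => inner ℝ (b i) (Y x)) x (b i) =
      inner ℝ (b i) (fderiv ℝ Y x (b i)) := fun i x => by
    have h1 := (innerSL ℝ (b i)).hasFDerivAt.comp x (hY.differentiable one_ne_zero x).hasFDerivAt
    have h2 : fderiv ℝ (fun x => inner ℝ (b i) (Y x)) x = _ := h1.fderiv
    rw [h2]
    rfl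
  have hYi : ∀ i, Continuous fun x => inner ℝ (b i) (Y x) := fun i =>
    continuous_const.inner hY.continuous
  have hdYi : ∀ i, Continuous fun x => inner ℝ (b i) (fderiv ℝ Y x (b i)) := fun i =>
    continuous_const.inner (hdY.clm_apply continuous_const)
  have hi1 : ∀ i, Integrable fun x => inner ℝ (b i) (Y x) * fderiv ℝ u x (b i) := fun i =>
    integrable_of_continuous_of_support ((hYi i).mul (hdu.clm_apply continuous_const))
      (hcd (b i)) fun x hx => by rw [hx, mul_zero]
  have hi2 : ∀ i, Integrable fun x => inner ℝ (b i) (fderiv ℝ Y x (b i)) * u x := fun i =>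
    integrable_of_continuous_of_support ((hdYi i).mul hu.continuous)
      hc fun x hx => by rw [hx, mul_zero]
  have hi3 : ∀ i, Integrable fun x => inner ℝ (b i) (Y x) * u x := fun i =>
    integrable_of_continuous_of_support ((hYi i).mul hu.continuous)
      hc fun x hx => by rw [hx, mul_zero]
  have hparts : ∀ i, ∫ x, inner ℝ (b i) (Y x) * fderiv ℝ u x (b i) =
      -∫ x, inner ℝ (b i) (fderiv ℝ Y x (b i)) * u x := fun i => by
    have h := integral_mul_fderiv_eq_neg_fderiv_mul_of_integrable (μ := (volume : Measure E))
      (f := fun x => inner ℝ (b i) (Y x)) (g := u) (v := b i)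
      (by simpa only [hfd] using hi2 i) (hi1 i) (hi3 i)
      (fun x _ => ((innerSL ℝ (b i)).differentiable.comp (hY.differentiable one_ne_zero)) x)
      (fun x _ => hu.differentiable one_ne_zero x)
    simpa only [hfd] using h
  have hsum : ∀ x, fderiv ℝ u x (Y x) + u x * ∑ i, inner ℝ (b i) (fderiv ℝ Y x (b i)) =
      ∑ i, (inner ℝ (b i) (Y x) * fderiv ℝ u x (b i) +
        inner ℝ (b i) (fderiv ℝ Y x (b i)) * u x) := fun x => by
    rw [Finset.sum_add_distrib, ← Finset.sum_mul, mul_comm (u x)]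
    congr 1
    -- Only the argument of the differential is expanded in the basis.
    conv_lhs => rw [← b.sum_repr' (Y x), map_sum]
    simp
  simp_rw [hsum]
  have hi : ∀ i, Integrable fun x => inner ℝ (b i) (Y x) * fderiv ℝ u x (b i) +
      inner ℝ (b i) (fderiv ℝ Y x (b i)) * u x := fun i => (hi1 i).add (hi2 i)
  rw [integral_finsetSum _ fun i _ => hi i]
  refine Finset.sum_eq_zero fun i _ => ?_
  rw [integral_add (hi1 i) (hi2 i), hparts i, neg_add_cancel]

theorem measurableEmbedding_val : MeasurableEmbedding (val : CH m → Cn m) :=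
  isOpenEmbedding_val.measurableEmbedding

theorem vol_eq : vol m = (Measure.comap val volume).withDensity
    fun z : CH m => ENNReal.ofReal ((1 - ‖z.val‖ ^ 2)⁻¹ ^ (m + 1)) := by
  simp only [vol, sqrt_det_gram]

theorem continuous_density :
    Continuous fun z : CH m => (1 - ‖z.val‖ ^ 2)⁻¹ ^ (m + 1) :=
  ((continuous_const.sub (isOpenEmbedding_val.continuous.norm.pow 2)).inv₀
    fun z => (one_sub_norm_sq_pos z.norm_val_lt_one).ne').pow _

instance : IsLocallyFiniteMeasure (vol m) := by
  have : IsLocallyFiniteMeasure (Measure.comap (val : CH m → Cn m) volume) := by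
    have := isOpenEmbedding_val.locallyCompactSpace (X := CH m)
    have : IsFiniteMeasureOnCompacts (Measure.comap (val : CH m → Cn m) volume) :=
      .comap' _ isOpenEmbedding_val.continuous measurableEmbedding_val
    infer_instance
  rw [vol_eq]
  exact IsLocallyFiniteMeasure.withDensity_ofReal continuous_density

/-- Allows the pole `x₀` to be discarded in the final limit. -/
instance [Nontrivial (Cn m)] : NullSingletonClass (vol m) := by
  have : NullSingletonClass (Measure.comap (val : CH m → Cn m) volume) := by
    refine ⟨fun z => ?_⟩
    rw [measurableEmbedding_val.comap_apply, Set.image_singleton]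
    exact measure_singleton _
  exact ⟨fun z => withDensity_absolutelyContinuous _ _ (measure_singleton z)⟩

theorem integral_vol (h : Cn m → ℝ) :
    ∫ z : CH m, h z.val ∂(vol m) =
      ∫ x in Metric.ball (0 : Cn m) 1, (1 - ‖x‖ ^ 2)⁻¹ ^ (m + 1) * h x := by
  have hr : Set.range (val : CH m → Cn m) = Metric.ball 0 1 := Subtype.range_coe
  rw [vol_eq, integral_withDensity_eq_integral_toReal_smul
    continuous_density.measurable.ennreal_ofReal (by simp), ← hr,
    ← measurableEmbedding_val.map_comap, measurableEmbedding_val.integral_map]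
  refine integral_congr_ae (Filter.Eventually.of_forall fun z => ?_)
  have := one_sub_norm_sq_pos z.norm_val_lt_one
  simp only [smul_eq_mul]
  rw [ENNReal.toReal_ofReal (by positivity)]

instance : T2Space (CH m) := inferInstanceAs (T2Space (Metric.ball (0 : Cn m) 1))

/-! ### Extension by zero and the Riemannian gradient -/

/-- The extension by zero of a function on the ball. -/
noncomputable def extend (φ : CH m → ℝ) : Cn m → ℝ := Function.extend val φ 0

@[simp] theorem extend_val (φ : CH m → ℝ) (z : CH m) : extend φ z.val = φ z :=
  isOpenEmbedding_val.injective.extend_apply φ 0 z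

theorem extend_eq_zero {φ : CH m → ℝ} {x : Cn m} (hx : x ∉ val '' tsupport φ) :
    extend φ x = 0 := by
  by_cases h : ∃ z : CH m, z.val = x
  · obtain ⟨z, rfl⟩ := h
    rw [extend_val]
    exact image_eq_zero_of_notMem_tsupport fun hz => hx ⟨z, hz, rfl⟩
  · exact Function.extend_apply' _ _ _ h

theorem isCompact_image_tsupport {φ : CH m → ℝ} (hc : HasCompactSupport φ) :
    IsCompact (val '' tsupport φ) :=
  hc.isCompact.image isOpenEmbedding_val.continuous

theorem hasCompactSupport_extend {φ : CH m → ℝ} (hc : HasCompactSupport φ) :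
    HasCompactSupport (extend φ) :=
  HasCompactSupport.intro (isCompact_image_tsupport hc) fun _ => extend_eq_zero

/-- Off the open ball, the extension by zero vanishes locally. -/
theorem extend_eventuallyEq_zero {φ : CH m → ℝ} (hc : HasCompactSupport φ) {x : Cn m}
    (hx : x ∉ Metric.ball (0 : Cn m) 1) : extend φ =ᶠ[nhds x] fun _ => 0 := by
  have hx' : x ∉ val '' tsupport φ := fun ⟨z, _, hz⟩ => hx (hz ▸ z.2)
  filter_upwards [(isCompact_image_tsupport hc).isClosed.isOpen_compl.mem_nhds hx'] with y hy
  exact extend_eq_zero hy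

theorem contDiff_extend {φ : CH m → ℝ} (hφ : ContMDiff 𝓘(ℝ, Cn m) 𝓘(ℝ, ℝ) ∞ φ)
    (hc : HasCompactSupport φ) : ContDiff ℝ ∞ (extend φ) := by
  refine contDiff_iff_contDiffAt.2 fun x => ?_
  by_cases hx : x ∈ Metric.ball (0 : Cn m) 1
  · have h1 := contMDiffOn_isOpenEmbedding_symm (I := 𝓘(ℝ, Cn m)) (n := ∞)
      (isOpenEmbedding_val (m := m))
    have hr : Set.range (val : CH m → Cn m) = Metric.ball 0 1 := Subtype.range_coe
    have h2 := (hφ.comp_contMDiffOn h1).contDiffOn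
    rw [hr] at h2
    refine (h2.contDiffAt (Metric.isOpen_ball.mem_nhds hx)).congr_of_eventuallyEq ?_
    filter_upwards [Metric.isOpen_ball.mem_nhds hx] with y hy
    have hz := isOpenEmbedding_val.toOpenPartialHomeomorph_right_inv (val : CH m → Cn m)
      (x := y) ⟨⟨y, hy⟩, rfl⟩
    exact (congrArg (extend φ) hz).symm.trans (extend_val φ _)
  · exact contDiffAt_const.congr_of_eventuallyEq (extend_eventuallyEq_zero hc hx)

/-- The Riemannian gradient, in terms of the Euclidean gradient `v`. -/
noncomputable def sharp (x v : Cn m) : Cn m := ((1 - ‖x‖ ^ 2 : ℝ) : ℂ) • (v - inner ℂ x v • x)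

theorem metricAt_sharp {x : Cn m} (hx : ‖x‖ < 1) (v w : Cn m) :
    metricAt x (sharp x v) w = inner ℝ v w := by
  have hx' := (one_sub_norm_sq_pos hx).ne'
  have h : inner ℂ v x = (starRingEnd ℂ) (inner ℂ x v) := (inner_conj_symm v x).symm
  rw [metricAt_apply, sharp, show inner ℝ v w = (inner ℂ v w).re from rfl]
  simp only [inner_smul_left, inner_sub_left, inner_self_complex, h]
  generalize inner ℂ x v = p
  generalize inner ℂ v w = q
  generalize inner ℂ x w = r
  generalize hs : 1 - ‖x‖ ^ 2 = s at *
  rw [show ‖x‖ ^ 2 = 1 - s by linarith]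
  simp
  field_simp
  ring

theorem mfderiv_eq_fderiv_extend {φ : CH m → ℝ} (hφ : ContMDiff 𝓘(ℝ, Cn m) 𝓘(ℝ, ℝ) ∞ φ)
    (hc : HasCompactSupport φ) (z : CH m) :
    mfderiv 𝓘(ℝ, Cn m) 𝓘(ℝ, ℝ) φ z = fderiv ℝ (extend φ) z.val := by
  have h := mfderiv_comp_val z ((contDiff_extend hφ hc).differentiable (by simp) z.val)
  rwa [show (fun z : CH m => extend φ z.val) = φ from funext (extend_val φ)] at h

theorem metricAt_grad {φ : CH m → ℝ} (hφ : ContMDiff 𝓘(ℝ, Cn m) 𝓘(ℝ, ℝ) ∞ φ)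
    (hc : HasCompactSupport φ) (z : CH m) (w : Cn m) :
    metricAt z.val (grad φ z) w = fderiv ℝ (extend φ) z.val w := by
  rw [← mfderiv_eq_fderiv_extend hφ hc]
  exact InnerProductSpace.toDual_symm_apply (𝕜 := ℝ) (E := TangentSpace 𝓘(ℝ, Cn m) z)
    (x := w) (y := mfderiv 𝓘(ℝ, Cn m) 𝓘(ℝ, ℝ) φ z)

theorem metricAt_left_injective (z : CH m) {v w : Cn m}
    (h : ∀ u, metricAt z.val v u = metricAt z.val w u) : v = w := by
  have h1 := metricAt_self z (v - w)
  have h2 : metricAt z.val (v - w) (v - w) = 0 := by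
    rw [map_sub (metricAt z.val), sub_apply, h, sub_self]
  rw [h2] at h1
  have : ‖v - w‖ = 0 := by nlinarith [norm_nonneg (v - w)]
  exact sub_eq_zero.1 (norm_eq_zero.1 this)

/-- Replaces the fibrewise norm by Euclidean data on `ℂ^m`, from which continuity in `z` is visible.
-/
theorem norm_grad_sq {φ : CH m → ℝ} (hφ : ContMDiff 𝓘(ℝ, Cn m) 𝓘(ℝ, ℝ) ∞ φ)
    (hc : HasCompactSupport φ) (z : CH m) :
    ‖grad φ z‖ ^ 2 = fderiv ℝ (extend φ) z.val
      (sharp z.val ((InnerProductSpace.toDual ℝ (Cn m)).symm (fderiv ℝ (extend φ) z.val))) := by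
  rw [norm_tangent_sq]
  refine (metricAt_grad hφ hc z _).trans (congrArg _ ?_)
  refine metricAt_left_injective z fun u => ?_
  rw [metricAt_grad hφ hc, metricAt_sharp z.norm_val_lt_one, InnerProductSpace.toDual_symm_apply]

theorem continuous_norm_grad_sq {φ : CH m → ℝ} (hφ : ContMDiff 𝓘(ℝ, Cn m) 𝓘(ℝ, ℝ) ∞ φ)
    (hc : HasCompactSupport φ) : Continuous fun z => ‖grad φ z‖ ^ 2 := by
  simp only [norm_grad_sq hφ hc]
  have hv : Continuous (val : CH m → Cn m) := isOpenEmbedding_val.continuous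
  have hd : Continuous fun z : CH m => fderiv ℝ (extend φ) z.val :=
    ((contDiff_extend hφ hc).continuous_fderiv (by simp)).comp hv
  have hg : Continuous fun z : CH m =>
      (InnerProductSpace.toDual ℝ (Cn m)).symm (fderiv ℝ (extend φ) z.val) :=
    (InnerProductSpace.toDual ℝ (Cn m)).symm.continuous.comp hd
  refine hd.clm_apply ?_
  exact (Complex.continuous_ofReal.comp (continuous_const.sub (hv.norm.pow 2))).smul
    (hg.sub ((hv.inner (𝕜 := ℂ) hg).smul hv))

theorem grad_eq_zero {φ : CH m → ℝ} {z : CH m} (hz : z ∉ tsupport φ) : grad φ z = 0 := by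
  have h : φ =ᶠ[nhds z] fun _ => 0 := notMem_tsupport_iff_eventuallyEq.1 hz
  have h1 : mfderiv 𝓘(ℝ, Cn m) 𝓘(ℝ, ℝ) φ z = 0 := by
    rw [h.mfderiv_eq]
    exact mfderiv_const
  rw [grad, h1]
  exact map_zero (InnerProductSpace.toDual ℝ (TangentSpace 𝓘(ℝ, Cn m) z)).symm

theorem integrable_norm_grad_sq {φ : CH m → ℝ} (hφ : ContMDiff 𝓘(ℝ, Cn m) 𝓘(ℝ, ℝ) ∞ φ)
    (hc : HasCompactSupport φ) : Integrable (fun z => ‖grad φ z‖ ^ 2) (vol m) := by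
  refine (continuous_norm_grad_sq hφ hc).integrable_of_hasCompactSupport
    (HasCompactSupport.intro hc.isCompact fun z hz => ?_)
  rw [grad_eq_zero hz]
  simp

/-! ### The divergence of the cut-off field -/

/-- The density of the divergence of `φ² H(F) ∇F`, with `H = cutField m n` and `F = coshSq a`. -/
noncomputable def divDensity (m n : ℕ) (a : Cn m) (f : Cn m → ℝ) (x : Cn m) : ℝ :=
  2 * f x * cutField m n (coshSq a x) * fderiv ℝ f x (gradCoshSq a x) +
    f x ^ 2 * (deriv (cutField m n) (coshSq a x) * (4 * coshSq a x * (coshSq a x - 1)) +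
      cutField m n (coshSq a x) * (4 * (m + 1) * coshSq a x - 4))

/-- The Riemannian divergence of `Y` is `(√g)⁻¹ div (√g Y)` with Euclidean `div`. The derivative of
the density along `∇F` completes the Euclidean divergence of `∇F` to `ΔF = 4(m+1)F - 4`. -/
theorem divDensity_eq (n : ℕ) {a : Cn m} (ha : ‖a‖ < 1) {f : Cn m → ℝ} {x : Cn m} (hx : ‖x‖ < 1)
    (hf : DifferentiableAt ℝ f x) {ι : Type*} [Fintype ι] (b : OrthonormalBasis ι ℝ (Cn m)) :
    fderiv ℝ (fun x => f x ^ 2 * ((1 - ‖x‖ ^ 2)⁻¹ ^ (m + 1) * cutField m n (coshSq a x))) x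
        (gradCoshSq a x) +
      f x ^ 2 * ((1 - ‖x‖ ^ 2)⁻¹ ^ (m + 1) * cutField m n (coshSq a x)) *
        ∑ i, inner ℝ (b i) (fderiv ℝ (gradCoshSq a) x (b i)) =
      (1 - ‖x‖ ^ 2)⁻¹ ^ (m + 1) * divDensity m n a f x := by
  have ha' := (one_sub_norm_sq_pos ha).ne'
  have hx' := (one_sub_norm_sq_pos hx).ne'
  rw [(hasFDerivAt_gradCoshSq a x).fderiv, sum_inner_fderivGradCoshSq ha]
  have h1 : HasFDerivAt (fun x : Cn m => (1 - ‖x‖ ^ 2)⁻¹ ^ (m + 1)) _ x :=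
    (hasDerivAt_pow (m + 1) _).comp_hasFDerivAt x ((hasDerivAt_inv hx').comp_hasFDerivAt x
      ((hasStrictFDerivAt_norm_sq x).hasFDerivAt.const_sub 1))
  have h2 : HasFDerivAt (fun x : Cn m => cutField m n (coshSq a x)) _ x :=
    ((contDiff_cutField m n).differentiable one_ne_zero
      (coshSq a x)).hasDerivAt.comp_hasFDerivAt x (hasFDerivAt_coshSq ha hx)
  have h3 : HasFDerivAt (fun x : Cn m => f x ^ 2) _ x :=
    (hasDerivAt_pow 2 _).comp_hasFDerivAt x hf.hasFDerivAt
  have h := (h3.mul (h1.mul h2)).fderiv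
  have hin : inner ℝ x (gradCoshSq a x) = 2 / (1 - ‖a‖ ^ 2) *
      (Complex.normSq (1 - inner ℂ a x) - (1 - ‖x‖ ^ 2) * (1 - inner ℂ a x).re) := by
    have hc : inner ℂ x a = (starRingEnd ℂ) (inner ℂ a x) := (inner_conj_symm x a).symm
    rw [show inner ℝ x (gradCoshSq a x) = (inner ℂ x (gradCoshSq a x)).re from rfl, gradCoshSq]
    simp only [inner_smul_right, inner_sub_right, inner_self_complex, hc]
    generalize inner ℂ a x = q
    generalize 2 / (1 - ‖a‖ ^ 2) = k
    generalize ‖x‖ ^ 2 = s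
    simp [Complex.normSq_apply]
    ring
  have hF : Complex.normSq (1 - inner ℂ a x) =
      coshSq a x * ((1 - ‖x‖ ^ 2) * (1 - ‖a‖ ^ 2)) := by
    rw [coshSq]
    field_simp
  refine (congrArg (fun L : Cn m →L[ℝ] ℝ => L (gradCoshSq a x) + _) h).trans ?_
  simp only [add_apply, smul_apply, smul_eq_mul, metricAt_gradCoshSq_self ha hx, neg_apply,
    innerSL_apply_apply, hin, hF, divDensity, Nat.cast_add, Nat.cast_one, nsmul_eq_mul]
  simp only [add_tsub_cancel_right, Pi.mul_apply]
  generalize coshSq a x = F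
  generalize cutField m n F = H
  generalize deriv (cutField m n) F = H'
  generalize (1 - inner ℂ a x).re = N
  generalize fderiv ℝ f x (gradCoshSq a x) = L
  generalize 1 - ‖x‖ ^ 2 = s at *
  generalize 1 - ‖a‖ ^ 2 = c at *
  generalize f x = y
  simp
  field_simp
  ring

theorem contDiff_gradCoshSq (a : Cn m) : ContDiff ℝ ∞ (gradCoshSq a) :=
  (contDiff_const.mul (contDiff_const.sub (innerReal a).contDiff)).smul
    (contDiff_id.sub contDiff_const)

theorem integral_divDensity (n : ℕ) (x₀ : CH m) {φ : CH m → ℝ}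
    (hφ : ContMDiff 𝓘(ℝ, Cn m) 𝓘(ℝ, ℝ) ∞ φ) (hc : HasCompactSupport φ) :
    ∫ z : CH m, divDensity m n x₀.val (extend φ) z.val ∂(vol m) = 0 := by
  have ha := x₀.norm_val_lt_one
  have hf := contDiff_extend hφ hc
  set u : Cn m → ℝ := fun x => extend φ x ^ 2 *
    ((1 - ‖x‖ ^ 2)⁻¹ ^ (m + 1) * cutField m n (coshSq x₀.val x)) with hu
  -- The density and `coshSq` are singular on the unit sphere, but the extension of `φ` vanishes
  -- near every point off the open ball.
  have hu0 : ∀ x ∉ Metric.ball (0 : Cn m) 1, u =ᶠ[nhds x] fun _ => 0 := fun x hx => by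
    filter_upwards [extend_eventuallyEq_zero hc hx] with y hy
    simp [hu, hy]
  have hud : ContDiff ℝ 1 u := contDiff_iff_contDiffAt.2 fun x => by
    by_cases hx : x ∈ Metric.ball (0 : Cn m) 1
    · have hx1 := mem_ball_zero_iff.1 hx
      have h1 : ContDiffAt ℝ 1 (fun x : Cn m => (1 - ‖x‖ ^ 2)⁻¹ ^ (m + 1)) x :=
        ((contDiffAt_const.sub (contDiff_norm_sq ℝ).contDiffAt).inv
          (one_sub_norm_sq_pos hx1).ne').pow _
      have h2 : ContDiffAt ℝ 1 (fun x => cutField m n (coshSq x₀.val x)) x :=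
        (contDiff_cutField m n).contDiffAt.comp x
          (((contDiffOn_coshSq ha).contDiffAt (Metric.isOpen_ball.mem_nhds hx)).of_le (by simp))
      exact ((hf.contDiffAt.of_le (by simp)).pow 2).mul (h1.mul h2)
    · exact contDiffAt_const.congr_of_eventuallyEq (hu0 x hx)
  have huc : HasCompactSupport u := (hasCompactSupport_extend hc).mono fun x hx hx' => hx (by
    simp [hu, hx'])
  have h := integral_divergence_eq_zero (stdOrthonormalBasis ℝ (Cn m)) hud huc
    ((contDiff_gradCoshSq x₀.val).of_le (by simp))
  have h0 := setIntegral_eq_integral_of_forall_compl_eq_zero (μ := volume)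
    (s := Metric.ball (0 : Cn m) 1) (f := fun x => fderiv ℝ u x (gradCoshSq x₀.val x) +
      u x * ∑ i, inner ℝ (stdOrthonormalBasis ℝ (Cn m) i)
        (fderiv ℝ (gradCoshSq x₀.val) x (stdOrthonormalBasis ℝ (Cn m) i))) fun x hx => by
      rw [(hu0 x hx).fderiv_eq, (hu0 x hx).self_of_nhds]
      simp
  rw [h] at h0
  rw [integral_vol, ← h0]
  refine setIntegral_congr_fun Metric.isOpen_ball.measurableSet fun x hx => ?_
  exact (divDensity_eq n ha (mem_ball_zero_iff.1 hx) (hf.differentiable (by simp) x) _).symm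

theorem continuous_divDensity (n : ℕ) (x₀ : CH m) {φ : CH m → ℝ}
    (hφ : ContMDiff 𝓘(ℝ, Cn m) 𝓘(ℝ, ℝ) ∞ φ) (hc : HasCompactSupport φ) :
    Continuous fun z : CH m => divDensity m n x₀.val (extend φ) z.val := by
  have ha := x₀.norm_val_lt_one
  have hf := contDiff_extend hφ hc
  have hv : Continuous (val : CH m → Cn m) := isOpenEmbedding_val.continuous
  have hF : Continuous fun z : CH m => coshSq x₀.val z.val :=
    (contDiffOn_coshSq ha).continuousOn.comp_continuous hv fun z => z.2
  have hH := (contDiff_cutField m n).continuous.comp hF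
  have hH' := ((contDiff_cutField m n).continuous_deriv le_rfl).comp hF
  have hφ' := hf.continuous.comp hv
  have hL := ((hf.continuous_fderiv (by simp)).comp hv).clm_apply
    ((contDiff_gradCoshSq x₀.val).continuous.comp hv)
  exact (((continuous_const.mul hφ').mul hH).mul hL).add ((hφ'.pow 2).mul
    ((hH'.mul ((continuous_const.mul hF).mul (hF.sub continuous_const))).add
      (hH.mul ((continuous_const.mul hF).sub continuous_const))))

theorem integrable_divDensity (n : ℕ) (x₀ : CH m) {φ : CH m → ℝ}
    (hφ : ContMDiff 𝓘(ℝ, Cn m) 𝓘(ℝ, ℝ) ∞ φ) (hc : HasCompactSupport φ) :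
    Integrable (fun z : CH m => divDensity m n x₀.val (extend φ) z.val) (vol m) := by
  refine (continuous_divDensity n x₀ hφ hc).integrable_of_hasCompactSupport
    (hc.mono fun z hz hz' => hz ?_)
  simp [divDensity, hz']

/-! ### The Hardy inequality -/

theorem metricAt_sub_smul_self_nonneg (z : CH m) (v w : Cn m) (c : ℝ) :
    0 ≤ metricAt z.val v v - 2 * c * metricAt z.val v w + c ^ 2 * metricAt z.val w w := by
  have h : 0 ≤ metricAt z.val (v - c • w) (v - c • w) :=
    (sq_nonneg _).trans (metricAt_self z _)
  have hs := metricAt_symm z.val w v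
  simp only [map_sub, map_smul, sub_apply, smul_apply, smul_eq_mul] at h
  rw [hs] at h
  linarith

/-- Pointwise form of the inequality: expand `|∇φ - φ H(F) ∇F|² ≥ 0` with `H = cutField m n` and
insert the Riccati inequality. -/
theorem cutoff_mul_hardyWeight_le {m : ℕ} (hm : 1 ≤ m) (n : ℕ) (x₀ : CH m) {φ : CH m → ℝ}
    (hφ : ContMDiff 𝓘(ℝ, Cn m) 𝓘(ℝ, ℝ) ∞ φ) (hc : HasCompactSupport φ) (z : CH m) :
    Real.smoothTransition (n * (coshSq x₀.val z.val - 1) - 1) *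
        (hardyWeight m (rdist z x₀) * φ z ^ 2) ≤
      ‖grad φ z‖ ^ 2 - divDensity m n x₀.val (extend φ) z.val := by
  have ha := x₀.norm_val_lt_one
  have hz := z.norm_val_lt_one
  have hF := one_le_coshSq ha hz
  obtain ⟨G, hL, hG⟩ : ∃ G : Cn m,
      (∀ w, metricAt z.val G w = fderiv ℝ (extend φ) z.val w) ∧
        metricAt z.val G G = ‖grad φ z‖ ^ 2 :=
    ⟨grad φ z, metricAt_grad hφ hc z, (norm_tangent_sq z _).symm⟩
  have hsq := metricAt_sub_smul_self_nonneg z G (gradCoshSq x₀.val z.val)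
    (φ z * cutField m n (coshSq x₀.val z.val))
  have hQ := metricAt_gradCoshSq_self ha hz
  have hric := cutField_riccati_le hm n hF
  -- The weight decreases and `arcoshSqrt F ≤ rdist`; where `F = 1` the cutoff vanishes, so
  -- monotonicity is needed only on `(0, ∞)`.
  have hw : Real.smoothTransition (n * (coshSq x₀.val z.val - 1) - 1) *
      hardyWeight m (rdist z x₀) ≤ Real.smoothTransition (n * (coshSq x₀.val z.val - 1) - 1) *
      hardyWeight m (arcoshSqrt (coshSq x₀.val z.val)) := by
    rcases hF.eq_or_lt with h1 | h1
    · rw [← h1]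
      simp [Real.smoothTransition.zero_of_nonpos]
    · have hD := arcoshSqrt_pos h1
      have hle := arcoshSqrt_coshSq_le_rdist z x₀
      exact mul_le_mul_of_nonneg_left
        (antitoneOn_hardyWeight m hD (hD.trans_le hle) hle) (Real.smoothTransition.nonneg _)
  rw [hG, hL, hQ] at hsq
  simp only [divDensity, extend_val]
  have h1 := mul_le_mul_of_nonneg_left hric (sq_nonneg (φ z))
  have h2 := mul_le_mul_of_nonneg_left hw (sq_nonneg (φ z))
  linarith

/-- The bound for each cutoff is uniform in `n`. Fatou's lemma in `ENNReal` gives finiteness and the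
inequality together, without prior integrability of the singular weight. -/
theorem hardyWeight_integral_le {m : ℕ} (hm : 1 ≤ m) (x₀ : CH m) {φ : CH m → ℝ}
    (hφ : ContMDiff 𝓘(ℝ, Cn m) 𝓘(ℝ, ℝ) ∞ φ) (hc : HasCompactSupport φ) :
    Integrable (fun z : CH m => hardyWeight m (rdist z x₀) * φ z ^ 2) (vol m) ∧
      ∫ z : CH m, hardyWeight m (rdist z x₀) * φ z ^ 2 ∂(vol m) ≤
        ∫ z : CH m, ‖grad φ z‖ ^ 2 ∂(vol m) := by
  have : Nontrivial (Cn m) := by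
    have : Nonempty (Fin m) := ⟨⟨0, hm⟩⟩
    exact inferInstanceAs (Nontrivial (EuclideanSpace ℂ (Fin m)))
  have ha := x₀.norm_val_lt_one
  have hr := measurable_rdist x₀
  have hW : Measurable fun z : CH m => hardyWeight m (rdist z x₀) * φ z ^ 2 := by
    refine Measurable.mul ?_ (hφ.continuous.measurable.pow_const 2)
    simp only [hardyWeight]
    fun_prop
  have hW0 : ∀ z : CH m, 0 ≤ hardyWeight m (rdist z x₀) * φ z ^ 2 := fun z =>
    mul_nonneg (hardyWeight_nonneg m ENNReal.toReal_nonneg) (sq_nonneg _)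
  have hG0 : 0 ≤ ∫ z : CH m, ‖grad φ z‖ ^ 2 ∂(vol m) :=
    integral_nonneg fun z => sq_nonneg _
  have hF : Continuous fun z : CH m => coshSq x₀.val z.val :=
    (contDiffOn_coshSq ha).continuousOn.comp_continuous isOpenEmbedding_val.continuous
      fun z => z.2
  let W : ℕ → CH m → ENNReal := fun n z => ENNReal.ofReal
    (Real.smoothTransition (n * (coshSq x₀.val z.val - 1) - 1) *
      (hardyWeight m (rdist z x₀) * φ z ^ 2))
  have hWm : ∀ n, Measurable (W n) := fun n => by
    have : Continuous fun z : CH m =>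
        Real.smoothTransition (n * (coshSq x₀.val z.val - 1) - 1) :=
      Real.smoothTransition.continuous.comp (by fun_prop)
    exact (this.measurable.mul hW).ennreal_ofReal
  have hWle : ∀ n, ∫⁻ z, W n z ∂(vol m) ≤ ENNReal.ofReal (∫ z : CH m, ‖grad φ z‖ ^ 2 ∂(vol m)) :=
    fun n => by
    have hi1 := integrable_norm_grad_sq hφ hc
    have hi2 := integrable_divDensity n x₀ hφ hc
    have hp := cutoff_mul_hardyWeight_le hm n x₀ hφ hc
    calc ∫⁻ z, W n z ∂(vol m)
        ≤ ∫⁻ z : CH m, ENNReal.ofReal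
            (‖grad φ z‖ ^ 2 - divDensity m n x₀.val (extend φ) z.val) ∂(vol m) :=
          lintegral_mono fun z => ENNReal.ofReal_le_ofReal (hp z)
      _ = ENNReal.ofReal (∫ z : CH m,
            (‖grad φ z‖ ^ 2 - divDensity m n x₀.val (extend φ) z.val) ∂(vol m)) :=
          (ofReal_integral_eq_lintegral_ofReal (hi1.sub hi2)
            (Filter.Eventually.of_forall fun z => (mul_nonneg (Real.smoothTransition.nonneg _)
              (hW0 z)).trans (hp z))).symm
      _ = _ := by rw [integral_sub hi1 hi2, integral_divDensity n x₀ hφ hc, sub_zero]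
  have hlim : ∀ᵐ z ∂(vol m), ENNReal.ofReal (hardyWeight m (rdist z x₀) * φ z ^ 2) =
      Filter.liminf (fun n => W n z) Filter.atTop := by
    filter_upwards [compl_mem_ae_iff.2 (measure_singleton x₀)] with z hz
    have hne : z.val ≠ x₀.val := fun h => hz (isOpenEmbedding_val.injective h)
    have h1 : 0 < coshSq x₀.val z.val - 1 := by
      linarith [one_lt_coshSq ha z.norm_val_lt_one hne]
    refine (Filter.Tendsto.liminf_eq (tendsto_const_nhds.congr' ?_)).symm
    -- From this index on the argument `n (F - 1) - 1` of the cutoff is at least `1`, so the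
    -- sequence is eventually constant.
    obtain ⟨N, hN⟩ := exists_nat_ge (2 / (coshSq x₀.val z.val - 1))
    filter_upwards [Filter.eventually_ge_atTop N] with n hn
    have hn' : 2 ≤ n * (coshSq x₀.val z.val - 1) :=
      (div_le_iff₀ h1).1 (hN.trans (Nat.cast_le.2 hn))
    simp only [W]
    rw [Real.smoothTransition.one_of_one_le (by linarith), one_mul]
  have hfin : ∫⁻ z : CH m, ENNReal.ofReal (hardyWeight m (rdist z x₀) * φ z ^ 2) ∂(vol m) ≤
      ENNReal.ofReal (∫ z : CH m, ‖grad φ z‖ ^ 2 ∂(vol m)) := by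
    rw [lintegral_congr_ae hlim]
    refine (lintegral_liminf_le hWm).trans ?_
    exact (Filter.liminf_le_liminf (Filter.Eventually.of_forall hWle)).trans_eq
      (Filter.liminf_const _)
  refine ⟨⟨hW.aestronglyMeasurable, ?_⟩, ?_⟩
  · rw [hasFiniteIntegral_iff_ofReal (Filter.Eventually.of_forall hW0)]
    exact hfin.trans_lt ENNReal.ofReal_lt_top
  · rw [integral_eq_lintegral_of_nonneg_ae (Filter.Eventually.of_forall hW0)
      hW.aestronglyMeasurable]
    exact ENNReal.toReal_le_of_le_ofReal hG0 hfin

theorem rdist_pos {x x₀ : CH m} (h : x ≠ x₀) : 0 < rdist x x₀ :=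
  (arcoshSqrt_pos (one_lt_coshSq x₀.norm_val_lt_one x.norm_val_lt_one
    fun h' => h (isOpenEmbedding_val.injective h'))).trans_le (arcoshSqrt_coshSq_le_rdist x x₀)

end CH

theorem lemma13 (m : ℕ) (hm : 1 ≤ m) (x₀ : CH m) :
    (∀ φ : CH m → ℝ, ContMDiff 𝓘(ℝ, Cn m) 𝓘(ℝ, ℝ) ∞ φ → HasCompactSupport φ →
      Integrable (fun x : CH m =>
        ((m : ℝ) ^ 2 + 1 / (4 * CH.rdist x x₀ ^ 2)
          + ((m : ℝ) - 1) ^ 2 / Real.sinh (CH.rdist x x₀) ^ 2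
          - 1 / Real.sinh (2 * CH.rdist x x₀) ^ 2) * φ x ^ 2) (CH.vol m) ∧
      Integrable (fun x : CH m => ‖CH.grad φ x‖ ^ 2) (CH.vol m) ∧
      ∫ x : CH m,
        ((m : ℝ) ^ 2 + 1 / (4 * CH.rdist x x₀ ^ 2)
          + ((m : ℝ) - 1) ^ 2 / Real.sinh (CH.rdist x x₀) ^ 2
          - 1 / Real.sinh (2 * CH.rdist x x₀) ^ 2) * φ x ^ 2 ∂(CH.vol m)
        ≤ ∫ x : CH m, ‖CH.grad φ x‖ ^ 2 ∂(CH.vol m)) ∧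
    (∀ x : CH m, x ≠ x₀ →
      0 < 1 / (4 * CH.rdist x x₀ ^ 2)
        + ((m : ℝ) - 1) ^ 2 / Real.sinh (CH.rdist x x₀) ^ 2
        - 1 / Real.sinh (2 * CH.rdist x x₀) ^ 2) := by
  refine ⟨fun φ hφ hc => ?_, fun x hx => CH.hardyWeight_sub_pos m (CH.rdist_pos hx)⟩
  obtain ⟨h1, h2⟩ := CH.hardyWeight_integral_le hm x₀ hφ hc
  exact ⟨h1, CH.integrable_norm_grad_sq hφ hc, h2⟩
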